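/- Setting. A finite-horizon stochastic game has a finite non-empty set of $n$ agents, finite non-empty local action sets $\mathcal A_i$, $\mathcal A=\prod_i\mathcal A_i$, a finite state set $\mathcal S$, a horizon $H$, transition probabilities $P_h(\cdot\mid s,a)$, rewards $r_{i,h}:\mathcal S\times\mathcal A\to[0,1]$ ($1\le h\le H$) and an initial state distribution. A policy $\pi$ assigns to each stage $h$ and state $s$ a distribution $\pi_h(\cdot\mid s)$ on $\mathcal A$, and $Q^\pi_{i,h}(s,a)=\mathbb E^\pi\big[\sum_{h'=h}^H r_{i,h'}(s_{h'},a_{h'})\mid s_h=s,a_h=a\big]$. The game is a Markov potential game if there are functions $\phi_h:\mathcal S\times\mathcal A\to\mathbb R$ (a stage potential) such that $\Phi^\pi_h(s,a):=\mathbb E^\pi\big[\sum_{h'=h}^H\phi_{h'}(s_{h'},a_{h'})\mid s_h=s,a_h=a\big]$ satisfies $$\Phi_h^\pi(s,a_i',a_{-i})-\Phi_h^\pi(s,a_i,a_{-i})=Q_{i,h}^\pi(s,a_i',a_{-i})-Q_{i,h}^\pi(s,a_i,a_{-i})$$ for all policies $\pi$, agents $i$, stages $h$, states $s$ and actions $a_i,a_i'\in\mathcal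 A_i$, $a_{-i}\in\mathcal A_{-i}$. Log-linear learning. For $\epsilon>0$ and reward functions $q_i:\mathcal A\to\mathbb R$, the kernel $K^\epsilon(\cdot\mid a;\{q_i\}_{i=1}^n)$ on $\mathcal A$ draws an agent $i$ uniformly at random and replaces $a_i$ by $a_i'\in\mathcal A_i$ with probability $\epsilon^{-q_i(a_i',a_{-i})}\big/\sum_{b\in\mathcal A_i}\epsilon^{-q_i(b,a_{-i})}$, keeping $a_{-i}$. Algorithm. The initial actions $(a^{(0)}_h(s))_{h,s}$ are drawn from an arbitrary joint distribution $\mu$; $V^{(0)}_{i,h}=0$, $Q^{(0)}_{i,h}=r_{i,h}$ and $V^{(t)}_{i,H+1}=0$ for all $t$. At each iteration $t=0,1,\dots$, given the past, the actions $a^{(t+1)}_h(s)\sim K^\epsilon\big(\cdot\mid a^{(t)}_h(s);\{Q^{(t)}_{i,h}(s,\cdot)\}_{i=1}^n\big)$ are drawn independently over all stages $h$ and states $s$, and $$V^{(t+1)}_{i,h}(s)=\tfrac{t}{t+1}V^{(t)}_{i,h}(s)+\tfrac1{t+1}Q^{(t)}_{i,h}\big(s,a^{(t)}_h(s)\big),\qquad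 Q^{(t+1)}_{i,h}(s,a)=r_{i,h}(s,a)+\sum_{s'}P_h(s'\mid s,a)V^{(t+1)}_{i,h+1}(s').$$ Claim. Let the game be a Markov potential game. 1. For every $\epsilon>0$ there is a policy $\pi^\epsilon$, not depending on $\mu$, such that for every $\mu$ and all $h,s,a$, $\Pr\big(a_h^{(t)}(s)=a\big)\to\pi^\epsilon_h(a\mid s)$ as $t\to\infty$. 2. There is a policy $\pi^\star$ with $\pi^\epsilon_h(a\mid s)\to\pi^\star_h(a\mid s)$ as $\epsilon\to0^+$, for all $h,s,a$. 3. For every stage potential $\phi$ of the game, $\pi^\star$ is potential-maximizing: $\Phi^{\pi^\star}_h(s,a)\ge\Phi^{\pi}_h(s,a)$ for all policies $\pi$, all stages $h$, all $s\in\mathcal S$ and all $a\in\mathcal A$. Moreover, at every stage $h$ and state $s$, $\pi^\star_h(\cdot\mid s)$ is supported on actions that maximize $\Phi_h^{\pi^\star}(s,\cdot)$ over $\mathcal A$. -/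

import Mathlib

open Filter Topology

noncomputable section

/-- A joint action: one local action for every agent. -/
abbrev JointAction {I : Type*} (A : I → Type*) : Type _ := ∀ i, A i

/-- A finite-horizon stochastic game with agents `I`, local action sets `A i`, states `S` and
stages `Fin H` (stage `h` of `1, …, H` is the element `h - 1` of `Fin H`). -/
structure StochasticGame (I : Type*) [Fintype I] [DecidableEq I]
    (A : I → Type*) [∀ i, Fintype (A i)] (S : Type*) [Fintype S] (H : ℕ) where
  /-- transition probabilities: `(P h s a).1 s'` is the probability of moving to `s'` -/
  P : Fin H → S → JointAction A → stdSimplex ℝ S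
  /-- stage rewards: `r i h s a` is the reward of agent `i` at stage `h` -/
  r : I → Fin H → S → JointAction A → ℝ
  /-- rewards lie in the unit interval -/
  r_mem : ∀ i h s a, r i h s a ∈ Set.Icc (0 : ℝ) 1
  /-- initial state distribution -/
  ρ : stdSimplex ℝ S

/-- A stochastic Markov policy: at every stage and state a probability distribution on joint
actions (agents may be correlated). -/
abbrev Policy {I : Type*} [Fintype I] [DecidableEq I]
    (A : I → Type*) [∀ i, Fintype (A i)] (S : Type*) (H : ℕ) : Type _ :=
  Fin H → S → stdSimplex ℝ (JointAction A)

/-- An assignment of a joint action to every stage and state: the actor's memory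
`(h, s) ↦ a_h(s)` at one iteration of the algorithm. -/
abbrev ActorState {I : Type*} (A : I → Type*) (S : Type*) (H : ℕ) : Type _ :=
  Fin H → S → JointAction A

section Definitions

variable {I : Type*} [Fintype I] [DecidableEq I]
  {A : I → Type*} [∀ i, Fintype (A i)] [∀ i, DecidableEq (A i)]
  {S : Type*} [Fintype S] [DecidableEq S] {H : ℕ}

namespace StochasticGame

/-- `M.visit π h s a k s' a'` is the probability, when play follows `π`, that
`(s_{h+k}, a_{h+k}) = (s', a')` given that `(s_h, a_h) = (s, a)`
(set to `0` beyond the horizon). -/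
def visit (M : StochasticGame I A S H) (π : Policy A S H) (h : Fin H) (s : S)
    (a : JointAction A) : ℕ → S → JointAction A → ℝ
  | 0 => fun s' a' => if s' = s ∧ a' = a then 1 else 0
  | k + 1 => fun s' a' =>
      if hk : (h : ℕ) + k + 1 < H then
        (∑ x : S, ∑ b : JointAction A,
          M.visit π h s a k x b * (M.P ⟨(h : ℕ) + k, by omega⟩ x b).1 s') *
          (π ⟨(h : ℕ) + k + 1, hk⟩ s').1 a'
      else 0

/-- `M.total g π h s a = 𝔼^π[∑_{h' ≥ h} g_{h'}(s_{h'}, a_{h'}) | s_h = s, a_h = a]`,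
for any stage function `g`. -/
def total (M : StochasticGame I A S H) (g : Fin H → S → JointAction A → ℝ)
    (π : Policy A S H) (h : Fin H) (s : S) (a : JointAction A) : ℝ :=
  ∑ h' ∈ Finset.Ici h, ∑ s' : S, ∑ a' : JointAction A,
    M.visit π h s a ((h' : ℕ) - (h : ℕ)) s' a' * g h' s' a'

/-- The `Q`-function `Q_{i,h}^π(s, a)` of agent `i`. -/
def Q (M : StochasticGame I A S H) (i : I) (π : Policy A S H) (h : Fin H) (s : S)
    (a : JointAction A) : ℝ :=
  M.total (M.r i) π h s a

/-- `φ` is a stage potential function of `M`: for every policy, stage and state, a unilateral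
change of action by agent `i` changes the total potential `Φ_h^π = M.total φ π h` by exactly as
much as it changes `Q_{i,h}^π`. -/
def IsStagePotential (M : StochasticGame I A S H) (φ : Fin H → S → JointAction A → ℝ) : Prop :=
  ∀ (π : Policy A S H) (h : Fin H) (s : S) (i : I) (a : JointAction A) (b : A i),
    M.total φ π h s (Function.update a i b) - M.total φ π h s a =
      M.Q i π h s (Function.update a i b) - M.Q i π h s a

/-- Markov potential game. -/
def IsMarkovPotentialGame (M : StochasticGame I A S H) : Prop :=
  ∃ φ : Fin H → S → JointAction A → ℝ, M.IsStagePotential φ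

/-- `πs` is potential-maximizing for the stage potential `φ`: it maximizes
`Φ_h^π(s, a)` over all policies, simultaneously at all stages, states and actions. -/
def IsPotentialMaximizing (M : StochasticGame I A S H) (φ : Fin H → S → JointAction A → ℝ)
    (πs : Policy A S H) : Prop :=
  ∀ (π : Policy A S H) (h : Fin H) (s : S) (a : JointAction A),
    M.total φ π h s a ≤ M.total φ πs h s a

/-- The critic's second update: `Q_{i,h}(s,a) = r_{i,h}(s,a) + ∑_{s'} P_h(s'|s,a) V_{i,h+1}(s')`,
with `V_{i,H+1} = 0`. -/
def criticQ (M : StochasticGame I A S H) (V : I → Fin H → S → ℝ) (i : I) (h : Fin H) (s : S)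
    (a : JointAction A) : ℝ :=
  M.r i h s a + ∑ s' : S, (M.P h s a).1 s' *
    (if hh : (h : ℕ) + 1 < H then V i ⟨(h : ℕ) + 1, hh⟩ s' else 0)

/-- The critic's value estimates `V^{(t)}` as a function of the actions
`a^{(0)}, …, a^{(t-1)}` taken so far:
`V^{(t+1)}_{i,h}(s) = t/(t+1) V^{(t)}_{i,h}(s) + 1/(t+1) Q^{(t)}_{i,h}(s, a_h^{(t)}(s))`, where
`Q^{(t)} = M.criticQ V^{(t)}`.  Starting from `V^{(0)} = 0` gives `Q^{(0)} = r`. -/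
def criticV (M : StochasticGame I A S H) :
    (t : ℕ) → (Fin t → ActorState A S H) → I → Fin H → S → ℝ
  | 0, _ => fun _ _ _ => 0
  | t + 1, α => fun i h s =>
      (t : ℝ) / ((t : ℝ) + 1) * M.criticV t (Fin.init α) i h s +
        1 / ((t : ℝ) + 1) *
          M.criticQ (M.criticV t (Fin.init α)) i h s (α (Fin.last t) h s)

/-- Probability that the actor-critic algorithm, run on `M` with initial actions drawn from `μ`
and with a learning rule `K` as actor, produces the actions `a^{(0)}, …, a^{(t)} = α 0, …, α t`.
Here `K q a a'` is the probability that the learning rule moves from `a` to `a'` when the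
reward functions of the agents are `q`.  At iteration `t`, the actions `a_h^{(t+1)}(s)` are drawn
independently over all stages `h` and states `s`, from `K` with rewards `Q_{i,h}^{(t)}(s, ·)`. -/
def pathProb (M : StochasticGame I A S H)
    (K : (I → JointAction A → ℝ) → JointAction A → JointAction A → ℝ)
    (μ : stdSimplex ℝ (ActorState A S H)) :
    (t : ℕ) → (Fin (t + 1) → ActorState A S H) → ℝ
  | 0, α => μ.1 (α 0)
  | t + 1, α =>
      M.pathProb K μ t (Fin.init α) *
        ∏ h : Fin H, ∏ s : S,
          K (fun i => M.criticQ (M.criticV t (Fin.init (Fin.init α))) i h s)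
            (α (Fin.last t).castSucc h s) (α (Fin.last (t + 1)) h s)

/-- The law `π_h^{(t)}(a | s)` of the algorithm's action `a_h^{(t)}(s)`. -/
def actionLaw (M : StochasticGame I A S H)
    (K : (I → JointAction A → ℝ) → JointAction A → JointAction A → ℝ)
    (μ : stdSimplex ℝ (ActorState A S H)) (t : ℕ) (h : Fin H) (s : S)
    (a : JointAction A) : ℝ :=
  ∑ α : Fin (t + 1) → ActorState A S H,
    if α (Fin.last t) h s = a then M.pathProb K μ t α else 0

end StochasticGame

/-- Log-linear learning with rate of mistakes `ε`: an agent `i` is drawn uniformly and its action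
is redrawn with probabilities proportional to `ε ^ (-r_i)`, the other agents' actions being kept.
(The sum over `i` has several non-zero terms only for `a' = a`.) -/
def logLinear (ε : ℝ) (r : I → JointAction A → ℝ) (a a' : JointAction A) : ℝ :=
  ∑ i : I,
    if ∀ j, j ≠ i → a' j = a j then
      1 / (Fintype.card I : ℝ) *
        (ε ^ (-r i a') / ∑ b : A i, ε ^ (-r i (Function.update a i b)))
    else 0

end Definitions

end

/-! Fix a stage potential `φ`. For each `ε`, backward induction produces a policy `π^ε` that at
every stage and state is the Gibbs distribution with weights `ε ^ (-Φ)`, where `Φ` is its own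
cumulative potential (`exists_policy_of_total`). At the policy `π^ε`, the potential identity says
that `Φ` is an exact potential for the one-shot game with rewards `Q_{i,h}^{π^ε}(s, ·)`, so detailed
balance makes the Gibbs distribution stationary for log-linear learning with these rewards.

The actor at `(h, s)` is a chain with a random, time-dependent kernel, and its convergence is proved
backward in `h`. If the critic's values at the next stage converge in mean, so do the `Q`-estimates
at stage `h`, and hence so do the transition probabilities. The limiting kernel is primitive. A
Poisson equation and a martingale bound then give a law of large numbers for the critic's average
(`IsPathLaw.tendsto_average`), which closes the induction in `tendsto_criticV`. An `ℓ¹` contraction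
gives convergence of the action laws to `π^ε` (`IsPathLaw.tendsto_law`).

As `ε → 0⁺` the potential of `π^ε` itself moves with `ε` and is multiplied by `log ε` in the Gibbs
exponent, so mere convergence of it would not determine the limit. A polynomial rate in `ε` absorbs
the logarithm and is inherited from stage to stage (`polyTendsto_total`). The limit `π^⋆` is uniform
on the maximizers of its own cumulative potential, and the Bellman recursion turns this into
optimality over all policies. Two stage potentials differ at a given state by a constant in the
action, so the conclusion holds for every one of them. -/

/-- Backward induction over the stages. -/
theorem Fin.backward_induction {H : ℕ} {p : Fin H → Prop}
    (step : ∀ h : Fin H, (∀ hh : (h : ℕ) + 1 < H, p ⟨(h : ℕ) + 1, hh⟩) → p h) (h : Fin H) : p h := by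
  suffices key : ∀ (n : ℕ) (h : Fin H), H - (h : ℕ) ≤ n → p h from key _ h le_rfl
  intro n
  induction n with
  | zero => intro h hn; omega
  | succ n ih => exact fun h hn => step h fun hh => ih _ (by simp only; omega)

theorem Finset.sum_comm_pairs {α β γ δ R : Type*} [Fintype α] [Fintype β] [Fintype γ] [Fintype δ]
    [AddCommMonoid R] (f : α → β → γ → δ → R) :
    ∑ x, ∑ b, ∑ y, ∑ c, f x b y c = ∑ y, ∑ c, ∑ x, ∑ b, f x b y c := by
  have := Finset.sum_comm (s := (Finset.univ : Finset (α × β)))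
    (t := (Finset.univ : Finset (γ × δ))) (f := fun p q => f p.1 p.2 q.1 q.2)
  simpa only [Fintype.sum_prod_type] using this

/-! ### Bellman recursion and dynamic programming. -/

namespace StochasticGame

section Bellman

variable {I : Type*} [Fintype I] [DecidableEq I]
  {A : I → Type*} [∀ i, Fintype (A i)] [∀ i, DecidableEq (A i)]
  {S : Type*} [Fintype S] [DecidableEq S] {H : ℕ} (M : StochasticGame I A S H)

/-- The definition of `visit` appends a last step; the Bellman recursion needs the first step split
off instead. Induction on `k` reconciles the two by exchanging sums. -/
theorem visit_succ (π : Policy A S H) (h : Fin H) (s : S) (a : JointAction A) (k : ℕ) (s' : S)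
    (a' : JointAction A) :
    M.visit π h s a (k + 1) s' a' =
      if hh : (h : ℕ) + 1 < H then
        ∑ x, ∑ b, (M.P h s a).1 x * (π ⟨(h : ℕ) + 1, hh⟩ x).1 b *
          M.visit π ⟨(h : ℕ) + 1, hh⟩ x b k s' a'
      else 0 := by
  induction k generalizing s' a' with
  | zero =>
    simp only [visit, Nat.add_zero, Fin.eta]
    split_ifs with hh
    · simp [ite_and, Finset.sum_ite_eq]
    · rfl
  | succ k ih =>
    rw [visit]
    simp only [ih]
    by_cases hk : (h : ℕ) + (k + 1) + 1 < H
    · have hh : (h : ℕ) + 1 < H := by omega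
      have hk' : (h : ℕ) + 1 + k + 1 < H := by omega
      have e : (⟨(h : ℕ) + (k + 1), by omega⟩ : Fin H) = ⟨(h : ℕ) + 1 + k, by omega⟩ :=
        Fin.ext (by simp only; omega)
      have e' : (⟨(h : ℕ) + (k + 1) + 1, hk⟩ : Fin H) = ⟨(h : ℕ) + 1 + k + 1, hk'⟩ :=
        Fin.ext (by simp only; omega)
      simp only [hk, hh, dite_true, visit, hk', e, e']
      simp only [Finset.sum_mul, Finset.mul_sum]
      rw [Finset.sum_comm_pairs]
      refine Finset.sum_congr rfl fun _ _ => Finset.sum_congr rfl fun _ _ =>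
        Finset.sum_congr rfl fun _ _ => Finset.sum_congr rfl fun _ _ => ?_
      ring
    · have hk' : ¬ (h : ℕ) + 1 + k + 1 < H := by omega
      simp [hk, visit, hk']

/-- The Bellman recursion for cumulative stage functions. -/
theorem total_eq (g : Fin H → S → JointAction A → ℝ) (π : Policy A S H) (h : Fin H) (s : S)
    (a : JointAction A) :
    M.total g π h s a = g h s a + ∑ s', (M.P h s a).1 s' *
      (if hh : (h : ℕ) + 1 < H then
        ∑ a', (π ⟨(h : ℕ) + 1, hh⟩ s').1 a' * M.total g π ⟨(h : ℕ) + 1, hh⟩ s' a' else 0) := by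
  rw [total, ← Finset.Ioi_insert, Finset.sum_insert (by simp)]
  congr 1
  · simp [visit, ite_and]
  · by_cases hh : (h : ℕ) + 1 < H
    · have hI : Finset.Ioi h = Finset.Ici (⟨(h : ℕ) + 1, hh⟩ : Fin H) := by
        ext x; rw [Finset.mem_Ioi, Finset.mem_Ici, Fin.lt_def, Fin.le_def, Nat.succ_le_iff]
      have hv : ∀ h' ∈ Finset.Ici (⟨(h : ℕ) + 1, hh⟩ : Fin H),
          ∑ s' : S, ∑ a' : JointAction A,
            M.visit π h s a ((h' : ℕ) - (h : ℕ)) s' a' * g h' s' a' =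
          ∑ x, ∑ b, (M.P h s a).1 x * ((π ⟨(h : ℕ) + 1, hh⟩ x).1 b *
            ∑ s' : S, ∑ a' : JointAction A,
              M.visit π ⟨(h : ℕ) + 1, hh⟩ x b ((h' : ℕ) - ((h : ℕ) + 1)) s' a' * g h' s' a') := by
        intro h' hh'
        have : (h : ℕ) + 1 ≤ h' := Fin.le_def.1 (Finset.mem_Ici.1 hh')
        have e : (h' : ℕ) - (h : ℕ) = ((h' : ℕ) - ((h : ℕ) + 1)) + 1 := by omega
        rw [e]
        simp only [visit_succ, hh, dite_true, Finset.sum_mul, Finset.mul_sum]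
        rw [Finset.sum_comm_pairs]
        refine Finset.sum_congr rfl fun _ _ => Finset.sum_congr rfl fun _ _ =>
          Finset.sum_congr rfl fun _ _ => Finset.sum_congr rfl fun _ _ => ?_
        ring
      rw [hI, Finset.sum_congr rfl hv, Finset.sum_comm]
      simp only [hh, dite_true, total, Finset.mul_sum]
      refine Finset.sum_congr rfl fun x _ => ?_
      rw [Finset.sum_comm]
    · have hI : Finset.Ioi h = ∅ := by
        ext x
        have := x.2
        rw [Finset.mem_Ioi, Fin.lt_def]
        simp only [Finset.notMem_empty, iff_false]
        omega
      simp [hI, hh]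

/-- `total` at stage `h` only depends on the policy at later stages. -/
theorem total_congr (g : Fin H → S → JointAction A → ℝ) {π π' : Policy A S H} (h : Fin H)
    (hπ : ∀ k, h < k → π k = π' k) (s : S) (a : JointAction A) :
    M.total g π h s a = M.total g π' h s a := by
  induction h using Fin.backward_induction generalizing s a with
  | step h ih =>
    rw [total_eq, total_eq]
    by_cases hh : (h : ℕ) + 1 < H
    · have hlt : h < ⟨(h : ℕ) + 1, hh⟩ := Fin.lt_def.2 (Nat.lt_succ_self _)
      simp only [hh, dite_true, hπ _ hlt, ih hh fun k hk => hπ k (hlt.trans hk)]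
    · simp [hh]

/-- Policies can be built by backward induction: the distribution at each stage may be any
function of the cumulative values at that stage. -/
theorem exists_policy_of_total (g : Fin H → S → JointAction A → ℝ)
    (G : (JointAction A → ℝ) → stdSimplex ℝ (JointAction A)) :
    ∃ π : Policy A S H, ∀ h s, π h s = G (M.total g π h s) := by
  suffices key : ∀ n : ℕ, ∃ π : Policy A S H, ∀ h : Fin H, H - (h : ℕ) ≤ n →
      ∀ s, π h s = G (M.total g π h s) by
    obtain ⟨π, hπ⟩ := key H
    exact ⟨π, fun h => hπ h (Nat.sub_le _ _)⟩
  intro n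
  induction n with
  | zero => exact ⟨fun _ _ => G 0, fun h hn => by omega⟩
  | succ n ih =>
    obtain ⟨π, hπ⟩ := ih
    -- One more sweep of `G`: it leaves `π` unchanged on the last `n` stages, where the identity
    -- already holds, and `total` at stage `h` sees only stages after `h`.
    refine ⟨fun h s => G (M.total g π h s), fun h hn s => ?_⟩
    refine congrArg G (funext fun a => M.total_congr g h (fun k hk => funext fun s => ?_) s a)
    exact hπ k (by rw [Fin.lt_def] at hk; omega) s

/-- A policy supported, at every stage and state, on the maximizers of its own cumulative values
maximizes the cumulative values over all policies. -/
theorem total_le_total_of_support {g : Fin H → S → JointAction A → ℝ} {πs : Policy A S H}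
    (hs : ∀ h s a, 0 < (πs h s).1 a → ∀ a', M.total g πs h s a' ≤ M.total g πs h s a)
    (π : Policy A S H) (h : Fin H) (s : S) (a : JointAction A) :
    M.total g π h s a ≤ M.total g πs h s a := by
  induction h using Fin.backward_induction generalizing s a with
  | step h ih =>
    rw [total_eq, total_eq]
    refine add_le_add le_rfl (Finset.sum_le_sum fun s' _ =>
      mul_le_mul_of_nonneg_left ?_ ((M.P h s a).2.1 s'))
    · split_ifs with hh
      · set k : Fin H := ⟨(h : ℕ) + 1, hh⟩
        -- The average of `M.total g πs k s'` under `πs` equals its maximum, so it dominates the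
        -- average under any `π`.
        calc ∑ a', (π k s').1 a' * M.total g π k s' a'
            ≤ ∑ a', (π k s').1 a' * ∑ b, (πs k s').1 b * M.total g πs k s' b := by
              refine Finset.sum_le_sum fun a' _ =>
                mul_le_mul_of_nonneg_left ((ih hh s' a').trans ?_) ((π k s').2.1 a')
              calc M.total g πs k s' a'
                  = ∑ b, (πs k s').1 b * M.total g πs k s' a' := by
                    rw [← Finset.sum_mul, (πs k s').2.2, one_mul]
                _ ≤ _ := by
                    refine Finset.sum_le_sum fun b _ => ?_
                    rcases ((πs k s').2.1 b).eq_or_lt with h0 | h0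
                    · rw [← h0]; simp
                    · exact mul_le_mul_of_nonneg_left (hs k s' b h0 a') h0.le
          _ = _ := by rw [← Finset.sum_mul, (π k s').2.2, one_mul]
      · exact le_rfl

end Bellman

/-! ### Comparison of stage potentials. -/

section Potential

/-- A function unchanged by unilateral deviations is constant. -/
theorem eq_of_forall_update_eq {I : Type*} [Fintype I] [DecidableEq I] {A : I → Type*} {β : Type*}
    {f : JointAction A → β} (hf : ∀ a i b, f (Function.update a i b) = f a) (a a' : JointAction A) :
    f a' = f a := by
  classical
  -- The coordinates of `a` are exchanged for those of `a'` one at a time.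
  have key : ∀ s : Finset I, f (fun i => if i ∈ s then a' i else a i) = f a := by
    intro s
    induction s using Finset.induction_on with
    | empty => simp
    | insert i s hi ih =>
      rw [← ih, ← hf (fun i => if i ∈ s then a' i else a i) i (a' i)]
      congr 1
      funext j
      by_cases hj : j = i
      · subst hj; simp
      · simp [hj]
  simpa using key Finset.univ

variable {I : Type*} [Fintype I] [DecidableEq I]
  {A : I → Type*} [∀ i, Fintype (A i)] [∀ i, DecidableEq (A i)]
  {S : Type*} [Fintype S] [DecidableEq S] {H : ℕ} {M : StochasticGame I A S H}

/-- Two stage potentials order the actions in the same way. -/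
theorem IsStagePotential.total_sub_total_eq {φ ψ : Fin H → S → JointAction A → ℝ}
    (hφ : M.IsStagePotential φ) (hψ : M.IsStagePotential ψ) (π : Policy A S H) (h : Fin H) (s : S)
    (a a' : JointAction A) :
    M.total φ π h s a' - M.total φ π h s a = M.total ψ π h s a' - M.total ψ π h s a := by
  have := eq_of_forall_update_eq (f := fun a => M.total φ π h s a - M.total ψ π h s a)
    (fun a i b => by linarith [hφ π h s i a b, hψ π h s i a b]) a a'
  linarith

end Potential

end StochasticGame

/-! ### Primitive stochastic matrices: contraction, perturbed chains, Poisson equation. -/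

/-- A row-stochastic matrix. -/
structure IsStochastic {X : Type*} [Fintype X] (K : Matrix X X ℝ) : Prop where
  nonneg : ∀ a b, 0 ≤ K a b
  sum_eq_one : ∀ a, ∑ b, K a b = 1

/-- A nonnegative sequence contracted every `N` steps up to a vanishing error tends to zero. -/
theorem tendsto_zero_of_le_mul_add {u e : ℕ → ℝ} {c : ℝ} (hc0 : 0 ≤ c) (hc1 : c < 1) {B : ℝ}
    (hu0 : ∀ t, 0 ≤ u t) (huB : ∀ t, u t ≤ B) (he : Tendsto e atTop (𝓝 0)) (N : ℕ)
    (h : ∀ t, u (t + N) ≤ c * u t + e t) : Tendsto u atTop (𝓝 0) := by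
  have hbdd : IsBoundedUnder (· ≤ ·) atTop u := isBoundedUnder_of ⟨B, huB⟩
  have hbdd' : IsBoundedUnder (· ≥ ·) atTop u := isBoundedUnder_of ⟨0, hu0⟩
  have hL : limsup u atTop ≤ 0 := by
    by_contra! hpos
    set L := limsup u atTop with hLdef
    -- With this margin, `L ≤ c * (L + η) + η` would give `(1 - c) * L ≤ (1 + c) * η < 2 * η = (1 -
    -- c) * L / 2`.
    have hη : 0 < (1 - c) * L / 4 := by nlinarith
    set η := (1 - c) * L / 4 with hηdef
    have h1 : ∀ᶠ t in atTop, u t < L + η :=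
      eventually_lt_of_limsup_lt (by linarith) hbdd
    have h2 : ∀ᶠ t in atTop, e t < η := he.eventually_lt_const hη
    have h3 : ∀ᶠ t in atTop, u (t + N) ≤ c * (L + η) + η := by
      filter_upwards [h1, h2] with t ht1 ht2
      nlinarith [h t]
    have h4 : ∀ᶠ t in atTop, u t ≤ c * (L + η) + η := by
      rw [← map_add_atTop_eq_nat N]
      exact h3
    have h5 : L ≤ c * (L + η) + η := limsup_le_of_le hbdd'.isCoboundedUnder_le h4
    nlinarith
  exact tendsto_of_le_liminf_of_limsup_le
    (le_liminf_of_le hbdd.isCoboundedUnder_ge (Eventually.of_forall hu0)) hL hbdd hbdd'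

namespace IsStochastic

open Matrix

variable {X : Type*} [Fintype X] {K : Matrix X X ℝ}

theorem mul {L : Matrix X X ℝ} (hK : IsStochastic K) (hL : IsStochastic L) :
    IsStochastic (K * L) where
  nonneg a b := Finset.sum_nonneg fun c _ => mul_nonneg (hK.nonneg a c) (hL.nonneg c b)
  sum_eq_one a := by
    simp only [Matrix.mul_apply]
    rw [Finset.sum_comm]
    simp only [← Finset.mul_sum, hL.sum_eq_one, mul_one, hK.sum_eq_one]

/-- A strictly positive stochastic matrix contracts row vectors of total mass zero in `ℓ¹`. -/
theorem exists_contraction [Nonempty X] {J : Matrix X X ℝ} (hJ : IsStochastic J)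
    (hpos : ∀ a b, 0 < J a b) :
    ∃ c, 0 ≤ c ∧ c < 1 ∧ ∀ v : X → ℝ, ∑ a, v a = 0 → ∑ b, |(v ᵥ* J) b| ≤ c * ∑ a, |v a| := by
  -- Doeblin's argument: subtracting the least entry `δ` from all entries does not change the action
  -- on vectors of mass zero, and leaves a nonnegative matrix with row sums `1 - |X| δ`.
  obtain ⟨⟨a₀, b₀⟩, hmin⟩ := Finite.exists_min (fun p : X × X => J p.1 p.2)
  set δ := J a₀ b₀
  have hδ : 0 < δ := hpos a₀ b₀
  have hmin' : ∀ a b, δ ≤ J a b := fun a b => hmin (a, b)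
  have hsum : ∀ a, ∑ b, (J a b - δ) = 1 - Fintype.card X * δ := fun a => by
    simp [Finset.sum_sub_distrib, hJ.sum_eq_one]
  have hcard : (0 : ℝ) < Fintype.card X := by exact_mod_cast Fintype.card_pos
  refine ⟨1 - Fintype.card X * δ, ?_, by nlinarith, fun v hv => ?_⟩
  · rw [← hsum a₀]
    exact Finset.sum_nonneg fun b _ => sub_nonneg.2 (hmin' _ _)
  · have h1 : ∀ b, |(v ᵥ* J) b| ≤ ∑ a, |v a| * (J a b - δ) := fun b => by
      have : (v ᵥ* J) b = ∑ a, v a * (J a b - δ) := by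
        simp only [Matrix.vecMul, dotProduct, mul_sub, Finset.sum_sub_distrib]
        rw [← Finset.sum_mul, hv, zero_mul, sub_zero]
      rw [this]
      refine (Finset.abs_sum_le_sum_abs _ _).trans (Finset.sum_le_sum fun a _ => ?_)
      rw [abs_mul, abs_of_nonneg (sub_nonneg.2 (hmin' a b))]
    refine (Finset.sum_le_sum fun b _ => h1 b).trans ?_
    rw [Finset.sum_comm]
    simp only [← Finset.mul_sum, hsum, ← Finset.sum_mul]
    rw [mul_comm]

variable [DecidableEq X]

theorem pow (hK : IsStochastic K) (N : ℕ) : IsStochastic (K ^ N) := by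
  induction N with
  | zero =>
    refine ⟨fun a b => ?_, fun a => ?_⟩
    · rw [pow_zero, Matrix.one_apply]; split_ifs <;> norm_num
    · simp [Matrix.one_apply]
  | succ N ih => rw [pow_succ]; exact ih.mul hK

/-- If the laws `p t` follow the kernel `K` up to a vanishing error, and `K` is primitive with
stationary distribution `π`, then `p t` tends to `π`. -/
theorem tendsto_of_asymptotic_step [Nonempty X] (hK : IsStochastic K) {N : ℕ}
    (hN : ∀ a b, 0 < (K ^ N) a b) {π : X → ℝ} (hπ1 : ∑ a, π a = 1) (hπ : π ᵥ* K = π)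
    {p : ℕ → X → ℝ} (hp0 : ∀ t a, 0 ≤ p t a) (hp1 : ∀ t, ∑ a, p t a = 1)
    (hstep : Tendsto (fun t => p (t + 1) - p t ᵥ* K) atTop (𝓝 0)) :
    Tendsto p atTop (𝓝 π) := by
  have hcont : ∀ L : Matrix X X ℝ, Continuous fun v : X → ℝ => v ᵥ* L := fun L =>
    Continuous.matrix_vecMul continuous_id continuous_const
  have hiter : ∀ j : ℕ, Tendsto (fun t => p (t + j) - p t ᵥ* K ^ j) atTop (𝓝 0) := by
    intro j
    induction j with
    | zero => simp
    | succ j ih =>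
      have h1 := (hstep.comp (tendsto_add_atTop_nat j)).add (((hcont K).tendsto 0).comp ih)
      simp only [Matrix.zero_vecMul, add_zero] at h1
      refine h1.congr fun t => ?_
      simp only [Function.comp, Matrix.sub_vecMul, Matrix.vecMul_vecMul, ← pow_succ, ← add_assoc]
      abel
  have hπN : π ᵥ* K ^ N = π := by
    induction N with
    | zero => simp
    | succ j ih =>
      have : ∀ j : ℕ, π ᵥ* K ^ j = π := fun j => by
        induction j with
        | zero => simp
        | succ j ih => rw [pow_succ, ← Matrix.vecMul_vecMul, ih, hπ]
      exact this _
  obtain ⟨c, hc0, hc1, hc⟩ := (hK.pow N).exists_contraction hN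
  have herr : Tendsto (fun t => ∑ b, |(p (t + N) - p t ᵥ* K ^ N) b|) atTop (𝓝 0) := by
    have : Continuous fun v : X → ℝ => ∑ b, |v b| := by fun_prop
    simpa [Function.comp_def] using (this.tendsto 0).comp (hiter N)
  have hπB : ∀ t, ∑ a, |(p t - π) a| ≤ 1 + ∑ a, |π a| := fun t => by
    rw [← hp1 t, ← Finset.sum_add_distrib]
    refine Finset.sum_le_sum fun a _ => (abs_sub _ _).trans ?_
    rw [abs_of_nonneg (hp0 t a)]
  have key : Tendsto (fun t => ∑ a, |(p t - π) a|) atTop (𝓝 0) := by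
    refine tendsto_zero_of_le_mul_add hc0 hc1 (fun t => Finset.sum_nonneg fun a _ => abs_nonneg _)
      hπB herr N fun t => ?_
    have h0 : ∑ a, (p t - π) a = 0 := by simp [hp1, hπ1]
    refine le_trans ?_ (add_le_add_left (hc _ h0) _)
    rw [← Finset.sum_add_distrib]
    refine Finset.sum_le_sum fun b _ => ?_
    -- The first term is contracted because `p t - π` has mass zero; the second is the vanishing
    -- `N`-step error.
    have : (p (t + N) - π) b = ((p t - π) ᵥ* K ^ N) b + (p (t + N) - p t ᵥ* K ^ N) b := by
      rw [Matrix.sub_vecMul, hπN]; simp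
    rw [this]
    exact abs_add_le _ _
  rw [tendsto_pi_nhds]
  intro a
  rw [tendsto_iff_norm_sub_tendsto_zero]
  refine squeeze_zero (fun t => norm_nonneg _) (fun t => ?_) key
  exact Finset.single_le_sum (f := fun a => |(p t - π) a|) (fun a _ => abs_nonneg _)
    (Finset.mem_univ a)

/-- A harmonic function of a primitive stochastic matrix is constant. -/
theorem eq_of_mulVec_eq [Nonempty X] (hK : IsStochastic K) {N : ℕ}
    (hN : ∀ a b, 0 < (K ^ N) a b) {g : X → ℝ} (hg : K *ᵥ g = g) : ∃ c, ∀ a, g a = c := by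
  obtain ⟨a, ha⟩ := Finite.exists_max g
  have hgN : ∀ j : ℕ, K ^ j *ᵥ g = g := fun j => by
    induction j with
    | zero => simp
    | succ j ih => rw [pow_succ, ← Matrix.mulVec_mulVec, hg, ih]
  -- Maximum principle: the maximum `g a` is an average of all values of `g` with strictly positive
  -- weights.
  have hsum : ∑ b, (K ^ N) a b * (g a - g b) = 0 := by
    have := congrFun (hgN N) a
    simp only [Matrix.mulVec, dotProduct] at this
    simp only [mul_sub, Finset.sum_sub_distrib, ← Finset.sum_mul, (hK.pow N).sum_eq_one, this]
    ring
  rw [Finset.sum_eq_zero_iff_of_nonneg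
    fun b _ => mul_nonneg (hN a b).le (sub_nonneg.2 (ha b))] at hsum
  refine ⟨g a, fun b => ?_⟩
  have := (mul_eq_zero.1 (hsum b (Finset.mem_univ b))).resolve_left (hN a b).ne'
  linarith

/-- Solvability of the Poisson equation for a primitive stochastic matrix. -/
theorem exists_poisson [Nonempty X] (hK : IsStochastic K) {N : ℕ}
    (hN : ∀ a b, 0 < (K ^ N) a b) {π : X → ℝ} (hπ1 : ∑ a, π a = 1) (hπ : π ᵥ* K = π)
    (f : X → ℝ) : ∃ g : X → ℝ, ∀ a, g a - ∑ b, K a b * g b = f a - ∑ b, π b * f b := by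
  -- Adding the rank-one projection onto constants makes `1 - K` invertible. Since `T` preserves the
  -- `π`-average, the solution of `T g = f - ∑ b, π b * f b` has `π`-average zero, and the added
  -- term then vanishes.
  set T : (X → ℝ) →ₗ[ℝ] (X → ℝ) :=
    Matrix.toLin' (1 - K + Matrix.of fun _ b => π b) with hT
  have hTa : ∀ g a, T g a = g a - ∑ b, K a b * g b + ∑ b, π b * g b := by
    intro g a
    simp only [hT, Matrix.toLin'_apply, Matrix.add_mulVec, Matrix.sub_mulVec, Matrix.one_mulVec,
      Pi.add_apply, Pi.sub_apply]
    simp [Matrix.mulVec, dotProduct]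
  have hπT : ∀ g, ∑ a, π a * T g a = ∑ a, π a * g a := by
    intro g
    have h1 : ∑ a, π a * ∑ b, K a b * g b = ∑ b, π b * g b := by
      conv_rhs => rw [← hπ]
      simp only [Matrix.vecMul, dotProduct, Finset.mul_sum, Finset.sum_mul]
      rw [Finset.sum_comm]
      simp only [mul_assoc]
    simp only [hTa, mul_add, mul_sub, Finset.sum_add_distrib, Finset.sum_sub_distrib, h1,
      ← Finset.sum_mul, hπ1, one_mul]
    ring
  have hinj : Function.Injective T := by
    rw [← LinearMap.ker_eq_bot, LinearMap.ker_eq_bot']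
    intro g hg
    have h0 : ∑ a, π a * g a = 0 := by rw [← hπT, hg]; simp
    have h1 : K *ᵥ g = g := by
      funext a
      have := hTa g a
      rw [hg, h0] at this
      simp only [Pi.zero_apply, add_zero] at this
      simp only [Matrix.mulVec, dotProduct]
      linarith
    obtain ⟨c, hc⟩ := hK.eq_of_mulVec_eq hN h1
    simp only [hc, ← Finset.sum_mul, hπ1, one_mul] at h0
    funext a
    rw [hc, h0]; rfl
  obtain ⟨g, hg⟩ := LinearMap.injective_iff_surjective.1 hinj (fun a => f a - ∑ b, π b * f b)
  have h0 : ∑ a, π a * g a = 0 := by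
    rw [← hπT, hg]
    simp only [mul_sub, Finset.sum_sub_distrib, ← Finset.sum_mul, hπ1, one_mul, sub_self]
  refine ⟨g, fun a => ?_⟩
  have := hTa g a
  rw [hg, h0] at this
  linarith

end IsStochastic

/-! ### Gibbs distributions and log-linear learning. -/

noncomputable section

/-- The Gibbs distribution with weights `exp (β Φ)`. -/
def gibbs {X : Type*} [Fintype X] [Nonempty X] (β : ℝ) (Φ : X → ℝ) : stdSimplex ℝ X :=
  ⟨fun a => Real.exp (β * Φ a) / ∑ b, Real.exp (β * Φ b),
    fun _ => div_nonneg (Real.exp_pos _).le (Finset.sum_nonneg fun _ _ => (Real.exp_pos _).le), by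
      rw [← Finset.sum_div]
      exact div_self (Finset.sum_pos (fun _ _ => Real.exp_pos _) Finset.univ_nonempty).ne'⟩

end

section LogLinear

theorem unilateral_update_eq {I : Type*} [DecidableEq I] {A : I → Type*} {i : I} {a a' : JointAction A} (h : ∀ j, j ≠ i → a' j = a j)
    (b : A i) : Function.update a' i b = Function.update a i b := by
  funext j
  by_cases hj : j = i
  · subst hj; simp
  · simp [hj, h j hj]

theorem logLinear_denom_pos {I : Type*} [DecidableEq I] {A : I → Type*} [∀ i, Fintype (A i)]
    {ε : ℝ} (hε : 0 < ε) (r : I → JointAction A → ℝ) (a : JointAction A)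
    (i : I) : 0 < ∑ b : A i, ε ^ (-r i (Function.update a i b)) :=
  Finset.sum_pos (fun _ _ => Real.rpow_pos_of_pos hε _) ⟨a i, Finset.mem_univ _⟩

variable {I : Type*} [Fintype I] [DecidableEq I] {A : I → Type*} [∀ i, Fintype (A i)]
  [∀ i, DecidableEq (A i)]

theorem sum_unilateral (i : I) (a : JointAction A) (f : JointAction A → ℝ) :
    ∑ a' : JointAction A, (if ∀ j, j ≠ i → a' j = a j then f a' else 0) =
      ∑ b : A i, f (Function.update a i b) := by
  rw [← Finset.sum_filter]
  have hup : ∀ a' : JointAction A, (∀ j, j ≠ i → a' j = a j) →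
      Function.update a i (a' i) = a' := fun a' h => by
    funext j
    by_cases hj : j = i
    · subst hj; simp
    · simp [hj, h j hj]
  refine Finset.sum_nbij' (fun a' => a' i) (fun b => Function.update a i b) ?_ ?_ ?_ ?_ ?_
  · simp
  · intro b _
    simp only [Finset.mem_filter, Finset.mem_univ, true_and]
    intro j hj
    simp [hj]
  · intro a' ha'
    exact hup a' (Finset.mem_filter.1 ha').2
  · simp
  · intro a' ha'
    simp only [hup a' (Finset.mem_filter.1 ha').2]

/-- Detailed balance of log-linear learning in a potential game. -/
theorem gibbs_mul_logLinear_comm [Nonempty (JointAction A)] {ε : ℝ} (hε : 0 < ε)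
    {r : I → JointAction A → ℝ} {Φ : JointAction A → ℝ}
    (hΦ : ∀ i a b, Φ (Function.update a i b) - Φ a = r i (Function.update a i b) - r i a)
    (a a' : JointAction A) :
    (gibbs (-Real.log ε) Φ).1 a * logLinear ε r a a' =
      (gibbs (-Real.log ε) Φ).1 a' * logLinear ε r a' a := by
  simp only [logLinear, Finset.mul_sum]
  -- Balance holds agent by agent: profiles differing only at `i` share the normalizing sum of agent
  -- `i`, and the remaining factors agree because `Φ a + r i a' = Φ a' + r i a`.
  refine Finset.sum_congr rfl fun i _ => ?_
  by_cases h : ∀ j, j ≠ i → a' j = a j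
  · have h' : ∀ j, j ≠ i → a j = a' j := fun j hj => (h j hj).symm
    have ha' : a' = Function.update a i (a' i) := by
      rw [← unilateral_update_eq h, Function.update_eq_self]
    have hΦ' : Φ a' - Φ a = r i a' - r i a := by
      have := hΦ i a (a' i)
      rwa [← ha'] at this
    rw [if_pos h, if_pos h']
    simp only [unilateral_update_eq h, gibbs]
    have hexp : Real.exp (-Real.log ε * Φ a) * ε ^ (-r i a') =
        Real.exp (-Real.log ε * Φ a') * ε ^ (-r i a) := by
      rw [Real.rpow_def_of_pos hε, Real.rpow_def_of_pos hε, ← Real.exp_add, ← Real.exp_add]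
      congr 1
      linear_combination Real.log ε * hΦ'
    simp only [div_eq_mul_inv]
    linear_combination (∑ b, Real.exp (-Real.log ε * Φ b))⁻¹ * (1 * (Fintype.card I : ℝ)⁻¹) *
      (∑ b : A i, ε ^ (-r i (Function.update a i b)))⁻¹ * hexp
  · have h' : ¬ ∀ j, j ≠ i → a j = a' j := fun h' => h fun j hj => (h' j hj).symm
    rw [if_neg h, if_neg h']
    simp

theorem continuous_logLinear {ε : ℝ} (hε : 0 < ε) (a a' : JointAction A) :
    Continuous fun r : I → JointAction A → ℝ => logLinear ε r a a' := by
  refine continuous_finsetSum _ fun i _ => ?_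
  split_ifs
  · refine continuous_const.mul (Continuous.div ?_ ?_ fun r => (logLinear_denom_pos hε r a i).ne')
    · exact Continuous.rpow continuous_const (by fun_prop) fun _ => Or.inl hε.ne'
    · exact continuous_finsetSum _ fun b _ =>
        Continuous.rpow continuous_const (by fun_prop) fun _ => Or.inl hε.ne'
  · exact continuous_const

variable [Nonempty I]

theorem logLinear_isStochastic {ε : ℝ} (hε : 0 < ε) (r : I → JointAction A → ℝ) :
    IsStochastic (Matrix.of (logLinear ε r)) where
  nonneg a a' := by
    refine Finset.sum_nonneg fun i _ => ?_
    have := logLinear_denom_pos hε r a i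
    split_ifs
    · positivity
    · exact le_rfl
  sum_eq_one a := by
    simp only [Matrix.of_apply, logLinear]
    rw [Finset.sum_comm]
    have hi : ∀ i : I, ∑ a' : JointAction A, (if ∀ j, j ≠ i → a' j = a j then
        1 / (Fintype.card I : ℝ) *
          (ε ^ (-r i a') / ∑ b : A i, ε ^ (-r i (Function.update a i b))) else 0) =
        1 / (Fintype.card I : ℝ) := fun i => by
      rw [sum_unilateral i a, ← Finset.mul_sum, ← Finset.sum_div,
        div_self (logLinear_denom_pos hε r a i).ne', mul_one]
    rw [Finset.sum_congr rfl fun i _ => hi i]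
    simp

theorem logLinear_pos {ε : ℝ} (hε : 0 < ε) (r : I → JointAction A → ℝ) (a : JointAction A)
    (i : I) (b : A i) : 0 < logLinear ε r a (Function.update a i b) := by
  have hden := logLinear_denom_pos hε r a
  have hcard : (0 : ℝ) < Fintype.card I := by exact_mod_cast Fintype.card_pos
  refine Finset.sum_pos' (fun k _ => ?_) ⟨i, Finset.mem_univ _, ?_⟩
  · have := hden k
    split_ifs
    · positivity
    · exact le_rfl
  · rw [if_pos fun j hj => by simp [hj]]
    have := hden i
    positivity

/-- Log-linear learning reaches every joint action in as many steps as there are agents. -/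
theorem logLinear_pow_pos {ε : ℝ} (hε : 0 < ε) (r : I → JointAction A → ℝ)
    (a a' : JointAction A) : 0 < (Matrix.of (logLinear ε r) ^ Fintype.card I) a a' := by
  suffices key : ∀ (n : ℕ) (a : JointAction A),
      (Finset.univ.filter fun i => a i ≠ a' i).card ≤ n →
      0 < (Matrix.of (logLinear ε r) ^ n) a a' from key _ a (Finset.card_le_univ _)
  intro n
  induction n with
  | zero =>
    intro a h
    have : a = a' := by
      funext i
      by_contra hi
      have := Finset.card_eq_zero.1 (Nat.le_zero.1 h)
      exact Finset.notMem_empty i (this ▸ Finset.mem_filter.2 ⟨Finset.mem_univ i, hi⟩)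
    simp [this]
  | succ n ih =>
    intro a h
    rw [pow_succ', Matrix.mul_apply]
    have hK := logLinear_isStochastic hε r
    obtain ⟨i, hi⟩ : ∃ i, (Finset.univ.filter
        fun j => Function.update a i (a' i) j ≠ a' j).card ≤ n := by
      by_cases hne : ∃ i, a i ≠ a' i
      · obtain ⟨i, hi⟩ := hne
        refine ⟨i, Nat.lt_succ_iff.1 (lt_of_lt_of_le (Finset.card_lt_card ?_) h)⟩
        rw [Finset.ssubset_iff_of_subset]
        · exact ⟨i, by simp [hi], by simp⟩
        · intro j hj
          simp only [Finset.mem_filter, Finset.mem_univ, true_and] at hj ⊢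
          by_cases hji : j = i
          · subst hji; simp at hj
          · simpa [hji] using hj
      -- The number of steps is fixed, so spare steps must be spent at `a'`: an arbitrary agent
      -- redraws its current action.
      · push Not at hne
        have : a = a' := funext hne
        exact ⟨Classical.arbitrary I, by simp [this]⟩
    exact Finset.sum_pos'
      (fun c _ => mul_nonneg (hK.nonneg a c) ((hK.pow n).nonneg c a'))
      ⟨_, Finset.mem_univ _, mul_pos (logLinear_pos hε r a i (a' i)) (ih _ hi)⟩

/-- In a potential game the Gibbs distribution is stationary for log-linear learning. -/
theorem gibbs_vecMul_logLinear [Nonempty (JointAction A)] {ε : ℝ} (hε : 0 < ε)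
    {r : I → JointAction A → ℝ} {Φ : JointAction A → ℝ}
    (hΦ : ∀ i a b, Φ (Function.update a i b) - Φ a = r i (Function.update a i b) - r i a) :
    Matrix.vecMul (gibbs (-Real.log ε) Φ).1 (Matrix.of (logLinear ε r)) =
      (gibbs (-Real.log ε) Φ).1 := by
  funext a'
  simp only [Matrix.vecMul, dotProduct, Matrix.of_apply]
  simp only [gibbs_mul_logLinear_comm hε hΦ _ a', ← Finset.mul_sum]
  have := (logLinear_isStochastic hε r).sum_eq_one a'
  simp only [Matrix.of_apply] at this
  rw [this, mul_one]

/-- Log-linear learning is stable in its rewards: up to an arbitrarily small constant, the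
transition probabilities change at most linearly. -/
theorem exists_logLinear_sub_le {ε : ℝ} (hε : 0 < ε) (r₀ : I → JointAction A → ℝ)
    (a a' : JointAction A) {η : ℝ} (hη : 0 < η) :
    ∃ C, 0 ≤ C ∧ ∀ r : I → JointAction A → ℝ,
      |logLinear ε r a a' - logLinear ε r₀ a a'| ≤ η + C * ∑ i, ∑ b, |r i b - r₀ i b| := by
  obtain ⟨δ, hδ, h⟩ := Metric.continuous_iff.1 (continuous_logLinear hε a a') r₀ η hη
  have hmem : ∀ r : I → JointAction A → ℝ, logLinear ε r a a' ∈ Set.Icc (0 : ℝ) 1 := fun r => by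
    have hK := logLinear_isStochastic hε r
    refine ⟨hK.nonneg a a', ?_⟩
    rw [← hK.sum_eq_one a]
    exact Finset.single_le_sum (f := Matrix.of (logLinear ε r) a) (fun b _ => hK.nonneg a b)
      (Finset.mem_univ a')
  -- Within `δ` of `r₀` continuity gives the error `η`; farther away the difference is at most `1`,
  -- which is at most `δ⁻¹` times the distance.
  refine ⟨δ⁻¹, by positivity, fun r => ?_⟩
  have hdist : dist r r₀ ≤ ∑ i, ∑ b, |r i b - r₀ i b| := by
    have hn : 0 ≤ ∑ i, ∑ b, |r i b - r₀ i b| :=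
      Finset.sum_nonneg fun i _ => Finset.sum_nonneg fun b _ => abs_nonneg _
    refine (dist_pi_le_iff hn).2 fun i => (dist_pi_le_iff hn).2 fun b => ?_
    rw [Real.dist_eq]
    exact (Finset.single_le_sum (f := fun b => |r i b - r₀ i b|) (fun b _ => abs_nonneg _)
      (Finset.mem_univ b)).trans (Finset.single_le_sum (f := fun i => ∑ b, |r i b - r₀ i b|)
      (fun i _ => Finset.sum_nonneg fun b _ => abs_nonneg _) (Finset.mem_univ i))
  rcases lt_or_ge (dist r r₀) δ with hlt | hge
  · have := h r hlt
    rw [Real.dist_eq] at this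
    have h2 : 0 ≤ δ⁻¹ * ∑ i, ∑ b, |r i b - r₀ i b| :=
      mul_nonneg (by positivity) (dist_nonneg.trans hdist)
    linarith
  · have h1 : |logLinear ε r a a' - logLinear ε r₀ a a'| ≤ 1 := by
      rw [abs_le]
      constructor <;> linarith [(hmem r).1, (hmem r).2, (hmem r₀).1, (hmem r₀).2]
    have h2 : 1 ≤ δ⁻¹ * ∑ i, ∑ b, |r i b - r₀ i b| := by
      rw [inv_mul_eq_div, one_le_div hδ]
      exact hge.trans hdist
    linarith

end LogLinear

/-! ### Limits at a polynomial rate in `ε`, stable under multiplication by `log ε`. -/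

section PolynomialRate

open Asymptotics


/-- `f` tends to `L` at `0⁺` at a polynomial rate. -/
def PolyTendsto (f : ℝ → ℝ) (L : ℝ) : Prop :=
  ∃ c : ℝ, 0 < c ∧ (fun ε => f ε - L) =O[𝓝[>] 0] fun ε => ε ^ c

namespace PolyTendsto

theorem rpow_isBigO {c d : ℝ} (h : c ≤ d) :
    (fun ε : ℝ => ε ^ d) =O[𝓝[>] 0] fun ε : ℝ => ε ^ c := by
  refine IsBigO.of_bound 1 ?_
  have : Set.Ioo (0 : ℝ) 1 ∈ 𝓝[>] (0 : ℝ) := Ioo_mem_nhdsGT one_pos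
  filter_upwards [this] with ε hε
  rw [Real.norm_of_nonneg (Real.rpow_nonneg hε.1.le _),
    Real.norm_of_nonneg (Real.rpow_nonneg hε.1.le _), one_mul]
  exact Real.rpow_le_rpow_of_exponent_ge hε.1 hε.2.le h

theorem tendsto_rpow {c : ℝ} (hc : 0 < c) : Tendsto (fun ε : ℝ => ε ^ c) (𝓝[>] 0) (𝓝 0) := by
  have h : ContinuousAt (fun ε : ℝ => ε ^ c) 0 :=
    Real.continuousAt_rpow_const _ _ (Or.inr hc.le)
  have := h.tendsto
  simp only [Real.zero_rpow hc.ne'] at this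
  exact this.mono_left nhdsWithin_le_nhds

theorem const (L : ℝ) : PolyTendsto (fun _ => L) L :=
  ⟨1, one_pos, by simpa using isBigO_zero _ _⟩

variable {f g : ℝ → ℝ} {L L' : ℝ}

theorem tendsto (h : PolyTendsto f L) : Tendsto f (𝓝[>] 0) (𝓝 L) := by
  obtain ⟨c, hc, h⟩ := h
  have := (h.trans_tendsto (tendsto_rpow hc)).add_const L
  simpa using this

theorem congr (h : PolyTendsto f L) (hfg : f =ᶠ[𝓝[>] 0] g) : PolyTendsto g L := by
  obtain ⟨c, hc, h⟩ := h
  exact ⟨c, hc, h.congr' (hfg.mono fun ε hε => by simp only [hε]) EventuallyEq.rfl⟩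

theorem add (hf : PolyTendsto f L) (hg : PolyTendsto g L') :
    PolyTendsto (fun ε => f ε + g ε) (L + L') := by
  obtain ⟨c, hc, hf⟩ := hf
  obtain ⟨d, hd, hg⟩ := hg
  refine ⟨min c d, lt_min hc hd, ?_⟩
  refine ((hf.trans (rpow_isBigO (min_le_left c d))).add
    (hg.trans (rpow_isBigO (min_le_right c d)))).congr_left fun ε => ?_
  ring

theorem mul (hf : PolyTendsto f L) (hg : PolyTendsto g L') :
    PolyTendsto (fun ε => f ε * g ε) (L * L') := by
  have hg1 : g =O[𝓝[>] 0] fun _ => (1 : ℝ) := hg.tendsto.isBigO_one ℝ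
  obtain ⟨c, hc, hf⟩ := hf
  obtain ⟨d, hd, hg⟩ := hg
  refine ⟨min c d, lt_min hc hd, ?_⟩
  have h1 := (hf.trans (rpow_isBigO (min_le_left c d))).mul hg1
  have h2 := (hg.trans (rpow_isBigO (min_le_right c d))).const_mul_left L
  simp only [mul_one] at h1
  refine (h1.add h2).congr_left fun ε => ?_
  ring

theorem sum {ι : Type*} {s : Finset ι} {f : ι → ℝ → ℝ} {L : ι → ℝ}
    (h : ∀ i ∈ s, PolyTendsto (f i) (L i)) :
    PolyTendsto (fun ε => ∑ i ∈ s, f i ε) (∑ i ∈ s, L i) := by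
  classical
  induction s using Finset.induction_on with
  | empty => simpa using const 0
  | insert i s hi ih =>
    simp only [Finset.sum_insert hi]
    exact (h i (Finset.mem_insert_self _ _)).add
      (ih fun j hj => h j (Finset.mem_insert_of_mem hj))

theorem inv (hf : PolyTendsto f L) (hL : L ≠ 0) : PolyTendsto (fun ε => (f ε)⁻¹) L⁻¹ := by
  have h1 : (fun ε => (f ε)⁻¹) =O[𝓝[>] 0] fun _ => (1 : ℝ) := (hf.tendsto.inv₀ hL).isBigO_one ℝ
  have hne : ∀ᶠ ε in 𝓝[>] (0 : ℝ), f ε ≠ 0 := hf.tendsto.eventually_ne hL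
  obtain ⟨c, hc, hf⟩ := hf
  refine ⟨c, hc, ?_⟩
  -- `f⁻¹ - L⁻¹ = -L⁻¹ * (f - L) * f⁻¹`, with the last factor bounded.
  have := (hf.const_mul_left (-L⁻¹)).mul h1
  simp only [mul_one] at this
  refine this.congr' (hne.mono fun ε hε => ?_) EventuallyEq.rfl
  simp only
  field_simp
  ring

/-- Half of the exponent is spent on the logarithm, since `log ε * ε ^ (c / 2)` stays bounded; the
other half remains as the rate. -/
theorem log_mul_rpow {c : ℝ} (hc : 0 < c) :
    (fun ε : ℝ => Real.log ε * ε ^ c) =O[𝓝[>] 0] fun ε : ℝ => ε ^ (c / 2) := by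
  have h : Tendsto (fun ε : ℝ => Real.log ε * ε ^ (c / 2)) (𝓝[>] 0) (𝓝 0) :=
    tendsto_log_mul_rpow_nhdsGT_zero (half_pos hc)
  have := (h.isBigO_one ℝ).mul (isBigO_refl (fun ε : ℝ => ε ^ (c / 2)) (𝓝[>] 0))
  simp only [one_mul] at this
  refine this.congr' ?_ EventuallyEq.rfl
  filter_upwards [self_mem_nhdsWithin] with ε hε
  rw [mul_assoc, ← Real.rpow_add hε]
  ring_nf

/-- If an exponent tends to `0` at a polynomial rate then `ε` raised to it tends to `1` at a
polynomial rate. -/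
theorem exp_log_mul (hf : PolyTendsto f 0) :
    PolyTendsto (fun ε => Real.exp (Real.log ε * f ε)) 1 := by
  obtain ⟨c, hc, hf⟩ := hf
  simp only [sub_zero] at hf
  have h1 : (fun ε => Real.log ε * f ε) =O[𝓝[>] 0] fun ε : ℝ => ε ^ (c / 2) :=
    ((isBigO_refl Real.log _).mul hf).trans (log_mul_rpow hc)
  have h2 : Tendsto (fun ε => Real.log ε * f ε) (𝓝[>] 0) (𝓝 0) :=
    h1.trans_tendsto (tendsto_rpow (half_pos hc))
  refine ⟨c / 2, half_pos hc, IsBigO.trans ?_ h1⟩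
  have h3 : (fun x : ℝ => Real.exp x - 1) =O[𝓝 0] fun x => x := by
    simpa using (Real.hasDerivAt_exp 0).isBigO_sub
  exact h3.comp_tendsto h2

/-- If an exponent has a positive limit then `ε` raised to it tends to `0` at a polynomial rate. -/
theorem exp_log_mul_zero (hf : Tendsto f (𝓝[>] 0) (𝓝 L)) (hL : 0 < L) :
    PolyTendsto (fun ε => Real.exp (Real.log ε * f ε)) 0 := by
  refine ⟨L / 2, half_pos hL, IsBigO.of_bound 1 ?_⟩
  have : Set.Ioo (0 : ℝ) 1 ∈ 𝓝[>] (0 : ℝ) := Ioo_mem_nhdsGT one_pos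
  filter_upwards [this, hf.eventually_const_lt (half_lt_self hL)] with ε hε hfε
  rw [sub_zero, Real.norm_of_nonneg (Real.exp_pos _).le,
    Real.norm_of_nonneg (Real.rpow_nonneg hε.1.le _), one_mul, Real.rpow_def_of_pos hε.1]
  exact Real.exp_le_exp.2 (mul_le_mul_of_nonpos_left hfε.le (Real.log_neg hε.1 hε.2).le)

end PolyTendsto

end PolynomialRate

/-! ### Concentration of Gibbs distributions on maximizers. -/

section ArgmaxUniform

variable {X : Type*} [Fintype X]

open Classical in
/-- The maximizers of a function on a finite type. -/
noncomputable def argmaxSet (L : X → ℝ) : Finset X := Finset.univ.filter fun a => ∀ b, L b ≤ L a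

theorem mem_argmaxSet {L : X → ℝ} {a : X} : a ∈ argmaxSet L ↔ ∀ b, L b ≤ L a := by
  simp [argmaxSet]

variable [Nonempty X]

theorem argmaxSet_nonempty (L : X → ℝ) : (argmaxSet L).Nonempty := by
  obtain ⟨a, ha⟩ := Finite.exists_max L
  exact ⟨a, mem_argmaxSet.2 ha⟩

open Classical in
/-- The uniform distribution on the maximizers of a function. -/
noncomputable def uniformArgmax (L : X → ℝ) : stdSimplex ℝ X :=
  ⟨fun a => if a ∈ argmaxSet L then ((argmaxSet L).card : ℝ)⁻¹ else 0,
    fun a => by dsimp only; split_ifs <;> positivity, by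
      have : ((argmaxSet L).card : ℝ) ≠ 0 := by
        exact_mod_cast (argmaxSet_nonempty L).card_pos.ne'
      simp [this]⟩

theorem le_of_uniformArgmax_pos {L : X → ℝ} {a : X} (h : 0 < (uniformArgmax L).1 a) (b : X) :
    L b ≤ L a := by
  by_contra hb
  have ha : a ∉ argmaxSet L := fun ha => hb (mem_argmaxSet.1 ha b)
  simp [uniformArgmax, ha] at h

/-- The Gibbs distribution concentrates at a polynomial rate on the maximizers of the limiting
potential, provided that the potential converges at a polynomial rate. -/
theorem PolyTendsto.gibbs {F : ℝ → X → ℝ} {L : X → ℝ} (hF : ∀ a, PolyTendsto (fun ε => F ε a) (L a))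
    (a : X) : PolyTendsto (fun ε => (gibbs (-Real.log ε) (F ε)).1 a) ((uniformArgmax L).1 a) := by
  classical
  obtain ⟨m, hm⟩ := argmaxSet_nonempty L
  have hm' := mem_argmaxSet.1 hm
  -- The Gibbs weights are rescaled by `ε ^ L m`, with `L m` the maximum of the limit; this cancels
  -- in the quotient and leaves weights tending to `1` on the maximizers and to `0` elsewhere.
  have hw : ∀ b, PolyTendsto (fun ε => Real.exp (Real.log ε * (L m + (-1) * F ε b)))
      (if b ∈ argmaxSet L then 1 else 0) := by
    intro b
    have hd : PolyTendsto (fun ε => L m + (-1) * F ε b) (L m + (-1) * L b) :=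
      (PolyTendsto.const _).add ((PolyTendsto.const _).mul (hF b))
    split_ifs with hb
    · have : L m + (-1) * L b = 0 := by linarith [mem_argmaxSet.1 hb m, hm' b]
      rw [this] at hd
      exact hd.exp_log_mul
    · refine PolyTendsto.exp_log_mul_zero hd.tendsto ?_
      by_contra hle
      exact hb (mem_argmaxSet.2 fun c => by linarith [hm' c])
  have hcard : (∑ b, if b ∈ argmaxSet L then (1 : ℝ) else 0) = (argmaxSet L).card := by simp
  have hne : (∑ b, if b ∈ argmaxSet L then (1 : ℝ) else 0) ≠ 0 := by
    rw [hcard]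
    exact_mod_cast (argmaxSet_nonempty L).card_pos.ne'
  have hsum := (PolyTendsto.sum (s := Finset.univ) fun b _ => hw b).inv hne
  have hfin := (hw a).mul hsum
  have hlim : (if a ∈ argmaxSet L then (1 : ℝ) else 0) *
      (∑ b, if b ∈ argmaxSet L then (1 : ℝ) else 0)⁻¹ = (uniformArgmax L).1 a := by
    rw [hcard]
    simp [uniformArgmax]
  rw [hlim] at hfin
  refine hfin.congr (Eventually.of_forall fun ε => ?_)
  have he : ∀ b, Real.exp (Real.log ε * (L m + (-1) * F ε b)) =
      Real.exp (Real.log ε * L m) * Real.exp (-Real.log ε * F ε b) := fun b => by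
    rw [← Real.exp_add]; ring_nf
  simp only [he, ← Finset.mul_sum, _root_.gibbs]
  rw [← div_eq_mul_inv, mul_div_mul_left _ _ (Real.exp_pos _).ne']

end ArgmaxUniform

namespace StochasticGame

variable {I : Type*} [Fintype I] [DecidableEq I]
  {A : I → Type*} [∀ i, Fintype (A i)] [∀ i, DecidableEq (A i)] [Nonempty (JointAction A)]
  {S : Type*} [Fintype S] [DecidableEq S] {H : ℕ} (M : StochasticGame I A S H)

/-- The cumulative potentials of Gibbs policies converge at a polynomial rate. -/
theorem polyTendsto_total {φ : Fin H → S → JointAction A → ℝ} {πε : ℝ → Policy A S H}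
    {πs : Policy A S H}
    (hπε : ∀ ε h s, πε ε h s = gibbs (-Real.log ε) (M.total φ (πε ε) h s))
    (hπs : ∀ h s, πs h s = uniformArgmax (M.total φ πs h s)) (h : Fin H) (s : S)
    (a : JointAction A) :
    PolyTendsto (fun ε => M.total φ (πε ε) h s a) (M.total φ πs h s a) := by
  induction h using Fin.backward_induction generalizing s a with
  | step h ih =>
    rw [total_eq]
    simp only [M.total_eq φ (πε _) h]
    refine (PolyTendsto.const _).add (PolyTendsto.sum fun s' _ => (PolyTendsto.const _).mul ?_)
    split_ifs with hh
    · refine PolyTendsto.sum fun a' _ => PolyTendsto.mul ?_ (ih hh s' a')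
      have := PolyTendsto.gibbs (ih hh s') a'
      rw [← hπs] at this
      simpa only [← hπε] using this
    · exact PolyTendsto.const 0

theorem polyTendsto_gibbs_policy {φ : Fin H → S → JointAction A → ℝ} {πε : ℝ → Policy A S H}
    {πs : Policy A S H}
    (hπε : ∀ ε h s, πε ε h s = gibbs (-Real.log ε) (M.total φ (πε ε) h s))
    (hπs : ∀ h s, πs h s = uniformArgmax (M.total φ πs h s)) (h : Fin H) (s : S)
    (a : JointAction A) :
    PolyTendsto (fun ε => (πε ε h s).1 a) ((πs h s).1 a) := by
  have := PolyTendsto.gibbs (M.polyTendsto_total hπε hπs h s) a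
  rw [← hπs] at this
  simpa only [← hπε] using this

end StochasticGame

/-! ### Random sequences with asymptotically homogeneous observations. -/

/-- `p t` is the law of the first `t + 1` values of a random sequence in a finite type whose
next value has conditional law `κ t β` given its past `β`. -/
structure IsPathLaw {Y : Type*} [Fintype Y] (p : ∀ t : ℕ, (Fin (t + 1) → Y) → ℝ)
    (κ : ∀ t : ℕ, (Fin (t + 1) → Y) → Y → ℝ) : Prop where
  zero_nonneg : ∀ α, 0 ≤ p 0 α
  zero_sum : ∑ α, p 0 α = 1
  kernel_nonneg : ∀ t β y, 0 ≤ κ t β y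
  kernel_sum : ∀ t β, ∑ y, κ t β y = 1
  succ : ∀ t (α : Fin (t + 2) → Y), p (t + 1) α = p t (Fin.init α) * κ t (Fin.init α) (α (Fin.last _))

/-- Expectation of a function of the first `t + 1` values. -/
def pathExpect {Y : Type*} [Fintype Y] (p : ∀ t : ℕ, (Fin (t + 1) → Y) → ℝ) (t : ℕ)
    (F : (Fin (t + 1) → Y) → ℝ) : ℝ :=
  ∑ α, p t α * F α

theorem Fin.sum_eq_sum_snoc {Y R : Type*} [Fintype Y] [AddCommMonoid R] {n : ℕ} (F : (Fin (n + 1) → Y) → R) :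
    ∑ α, F α = ∑ β : Fin n → Y, ∑ y, F (Fin.snoc (α := fun _ => Y) β y) := by
  rw [← Fintype.sum_prod_type']
  refine Fintype.sum_equiv
    (κ := (Fin n → Y) × Y) ⟨fun α => (Fin.init α, α (Fin.last n)), fun q =>
      Fin.snoc (α := fun _ => Y) q.1 q.2, fun α => Fin.snoc_init_self α, fun q => ?_⟩ _ _ fun α => ?_
  · simp [Fin.init_snoc]
  · simp [Fin.snoc_init_self]

section PathExpect

variable {Y : Type*} [Fintype Y] {p : ∀ t : ℕ, (Fin (t + 1) → Y) → ℝ}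

theorem pathExpect_add (t : ℕ) (F G : (Fin (t + 1) → Y) → ℝ) :
    pathExpect p t (fun α => F α + G α) = pathExpect p t F + pathExpect p t G := by
  simp [pathExpect, mul_add, Finset.sum_add_distrib]

theorem pathExpect_sub (t : ℕ) (F G : (Fin (t + 1) → Y) → ℝ) :
    pathExpect p t (fun α => F α - G α) = pathExpect p t F - pathExpect p t G := by
  simp [pathExpect, mul_sub, Finset.sum_sub_distrib]

theorem pathExpect_const_mul (t : ℕ) (c : ℝ) (F : (Fin (t + 1) → Y) → ℝ) :
    pathExpect p t (fun α => c * F α) = c * pathExpect p t F := by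
  simp only [pathExpect, Finset.mul_sum]
  exact Finset.sum_congr rfl fun _ _ => by ring

theorem pathExpect_sum (t : ℕ) {ι : Type*} (s : Finset ι) (F : ι → (Fin (t + 1) → Y) → ℝ) :
    pathExpect p t (fun α => ∑ i ∈ s, F i α) = ∑ i ∈ s, pathExpect p t (F i) := by
  simp only [pathExpect, Finset.mul_sum]
  exact Finset.sum_comm

/-- The martingale part of `g` along the observations. -/
def martingalePart {X : Type*} [Fintype X] (c : Y → X) (k : ∀ t : ℕ, (Fin (t + 1) → Y) → Matrix X X ℝ) (g : X → ℝ) :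
    ∀ t : ℕ, (Fin (t + 1) → Y) → ℝ
  | 0, _ => 0
  | t + 1, α => martingalePart c k g t (Fin.init α) +
      (g (c (α (Fin.last _))) -
        ∑ b, k t (Fin.init α) (c (Fin.init (α := fun _ => Y) α (Fin.last t))) b * g b)

end PathExpect

namespace IsPathLaw

variable {Y : Type*} [Fintype Y] {p : ∀ t : ℕ, (Fin (t + 1) → Y) → ℝ}
  {κ : ∀ t : ℕ, (Fin (t + 1) → Y) → Y → ℝ}

variable (hp : IsPathLaw p κ)
include hp

theorem tower (t : ℕ) (F : (Fin (t + 2) → Y) → ℝ) :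
    pathExpect p (t + 1) F =
      pathExpect p t fun β => ∑ y, κ t β y * F (Fin.snoc (α := fun _ => Y) β y) := by
  simp only [pathExpect]
  rw [Fin.sum_eq_sum_snoc]
  refine Finset.sum_congr rfl fun β _ => ?_
  simp only [hp.succ, Fin.init_snoc, Fin.snoc_last, Finset.mul_sum, mul_assoc]

theorem nonneg (t : ℕ) (α : Fin (t + 1) → Y) : 0 ≤ p t α := by
  induction t with
  | zero => exact hp.zero_nonneg α
  | succ t ih => rw [hp.succ]; exact mul_nonneg (ih _) (hp.kernel_nonneg _ _ _)

theorem expect_init (t : ℕ) (F : (Fin (t + 1) → Y) → ℝ) :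
    pathExpect p (t + 1) (fun α => F (Fin.init α)) = pathExpect p t F := by
  rw [hp.tower]
  simp only [Fin.init_snoc, ← Finset.sum_mul, hp.kernel_sum, one_mul]

theorem expect_const (t : ℕ) (c : ℝ) : pathExpect p t (fun _ => c) = c := by
  induction t with
  | zero => simp only [pathExpect, ← Finset.sum_mul, hp.zero_sum, one_mul]
  | succ t ih => exact (hp.expect_init t fun _ => c).trans ih

theorem mono (t : ℕ) {F G : (Fin (t + 1) → Y) → ℝ} (h : ∀ α, F α ≤ G α) :
    pathExpect p t F ≤ pathExpect p t G :=
  Finset.sum_le_sum fun α _ => mul_le_mul_of_nonneg_left (h α) (hp.nonneg t α)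

theorem expect_nonneg (t : ℕ) {F : (Fin (t + 1) → Y) → ℝ} (h : ∀ α, 0 ≤ F α) :
    0 ≤ pathExpect p t F :=
  Finset.sum_nonneg fun α _ => mul_nonneg (hp.nonneg t α) (h α)

theorem abs_le (t : ℕ) (F : (Fin (t + 1) → Y) → ℝ) :
    |pathExpect p t F| ≤ pathExpect p t fun α => |F α| := by
  refine (Finset.abs_sum_le_sum_abs _ _).trans (Finset.sum_le_sum fun α _ => ?_)
  rw [abs_mul, abs_of_nonneg (hp.nonneg t α)]

/-- The variance of `|F|` is nonnegative. -/
theorem expect_abs_le_sqrt (t : ℕ) (F : (Fin (t + 1) → Y) → ℝ) :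
    pathExpect p t (fun α => |F α|) ≤ √(pathExpect p t fun α => F α ^ 2) := by
  refine Real.le_sqrt_of_sq_le ?_
  set c := pathExpect p t fun α => |F α| with hc
  have h0 : 0 ≤ pathExpect p t fun α => (|F α| - c) ^ 2 := hp.expect_nonneg t fun α => sq_nonneg _
  have h1 : (pathExpect p t fun α => (|F α| - c) ^ 2) =
      (pathExpect p t fun α => F α ^ 2) - c ^ 2 := by
    have : (fun α => (|F α| - c) ^ 2) = fun α => (F α ^ 2 - (2 * c) * |F α|) + c ^ 2 := by
      funext α
      rw [sub_sq, sq_abs]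
      ring
    rw [this, pathExpect_add, pathExpect_sub, pathExpect_const_mul, ← hc, hp.expect_const]
    ring
  linarith

section Observation

variable {X : Type*} [Fintype X] {c : Y → X}
  {k : ∀ t : ℕ, (Fin (t + 1) → Y) → Matrix X X ℝ} {K : Matrix X X ℝ} {N : ℕ} {π : X → ℝ}

/-- If the conditional law of the observation `c` of the next value given the past tends in mean to
a primitive kernel `K` applied to the current observation, then the law of the observation tends
to the stationary distribution of `K`. -/
theorem tendsto_law [DecidableEq X] [Nonempty X]
    (hk : ∀ t β (F : X → ℝ), ∑ y, κ t β y * F (c y) = ∑ b, k t β (c (β (Fin.last t))) b * F b)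
    (hK : IsStochastic K) (hN : ∀ a b, 0 < (K ^ N) a b)
    (hπ1 : ∑ a, π a = 1) (hπ : Matrix.vecMul π K = π)
    (hkK : ∀ a b, Tendsto (fun t => pathExpect p t fun β => |k t β a b - K a b|) atTop (𝓝 0)) :
    Tendsto (fun t b => pathExpect p t fun β => if c (β (Fin.last t)) = b then 1 else 0)
      atTop (𝓝 π) := by
  set q : ℕ → X → ℝ := fun t b => pathExpect p t fun β => if c (β (Fin.last t)) = b then 1 else 0
    with hq
  refine hK.tendsto_of_asymptotic_step hN hπ1 hπ (p := q) (fun t b => hp.expect_nonneg t fun β => ?_)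
    (fun t => ?_) (tendsto_pi_nhds.2 fun b => ?_)
  · split_ifs <;> norm_num
  · rw [hq, ← pathExpect_sum]
    simp [hp.expect_const]
  · have h1 : ∀ t, q (t + 1) b = pathExpect p t fun β => k t β (c (β (Fin.last t))) b := fun t => by
      rw [hq]
      dsimp only
      rw [hp.tower]
      congr 1
      funext β
      simp only [Fin.snoc_last]
      rw [hk t β fun x => if x = b then 1 else 0]
      simp
    have h2 : ∀ t, Matrix.vecMul (q t) K b = pathExpect p t fun β => K (c (β (Fin.last t))) b :=
      fun t => by
        simp only [Matrix.vecMul, dotProduct, hq, mul_comm _ (K _ b)]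
        simp only [← pathExpect_const_mul]
        rw [← pathExpect_sum]
        simp
    -- The current observation is random, so its kernel error is bounded by the sum over all states.
    refine squeeze_zero_norm (a := fun t => ∑ a, pathExpect p t fun β => |k t β a b - K a b|)
      (fun t => ?_) ?_
    · rw [Pi.sub_apply, h1, h2, ← pathExpect_sub, Real.norm_eq_abs]
      refine (hp.abs_le t _).trans ?_
      rw [← pathExpect_sum]
      exact hp.mono t fun β => Finset.single_le_sum (f := fun a => |k t β a b - K a b|)
        (fun a _ => abs_nonneg _) (Finset.mem_univ _)
    · simpa using tendsto_finsetSum Finset.univ fun a _ => hkK a b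

/-- Increments have conditional mean zero and size at most `2 * G`, so they are orthogonal and the
second moment grows linearly. -/
theorem expect_martingalePart_sq_le
    (hk : ∀ t β (F : X → ℝ), ∑ y, κ t β y * F (c y) = ∑ b, k t β (c (β (Fin.last t))) b * F b)
    {g : X → ℝ} {G : ℝ} (hg : ∀ x, |g x| ≤ G) (t : ℕ) :
    (pathExpect p t fun α => martingalePart c k g t α ^ 2) ≤ t * (2 * G) ^ 2 := by
  induction t with
  | zero => simp [martingalePart, hp.expect_const]
  | succ t ih =>
    rw [hp.tower]
    have : (pathExpect p t fun β => martingalePart c k g t β ^ 2 + (2 * G) ^ 2) ≤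
        (t + 1 : ℕ) * (2 * G) ^ 2 := by
      rw [pathExpect_add, hp.expect_const]
      push_cast
      linarith
    refine (hp.mono t fun β => ?_).trans this
    simp only [martingalePart, Fin.init_snoc, Fin.snoc_last]
    set m := ∑ b, k t β (c (β (Fin.last t))) b * g b with hm
    set n := martingalePart c k g t β
    have hm' : ∑ y, κ t β y * g (c y) = m := hk t β g
    have hmG : |m| ≤ G := by
      rw [← hm']
      refine (Finset.abs_sum_le_sum_abs _ _).trans ?_
      calc ∑ y, |κ t β y * g (c y)| ≤ ∑ y, κ t β y * G := by
            refine Finset.sum_le_sum fun y _ => ?_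
            rw [abs_mul, abs_of_nonneg (hp.kernel_nonneg t β y)]
            exact mul_le_mul_of_nonneg_left (hg _) (hp.kernel_nonneg t β y)
        _ = G := by rw [← Finset.sum_mul, hp.kernel_sum, one_mul]
    calc ∑ y, κ t β y * (n + (g (c y) - m)) ^ 2
        -- Only the squared increment is estimated; the cross term stays exact, to cancel on
        -- averaging over `y`.
        ≤ ∑ y, (κ t β y * (n ^ 2 + (2 * G) ^ 2 - 2 * n * m) + 2 * n * (κ t β y * g (c y))) := by
          refine Finset.sum_le_sum fun y _ => ?_
          have h1 : (g (c y) - m) ^ 2 ≤ (2 * G) ^ 2 := by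
            rw [sq_le_sq]
            refine ((abs_sub _ _).trans (add_le_add (hg _) hmG)).trans ?_
            rw [← two_mul]
            exact le_abs_self _
          have := mul_le_mul_of_nonneg_left h1 (hp.kernel_nonneg t β y)
          nlinarith
      _ = n ^ 2 + (2 * G) ^ 2 := by
          rw [Finset.sum_add_distrib, ← Finset.sum_mul, ← Finset.mul_sum, hp.kernel_sum, hm']
          ring

/-- A law of large numbers in mean: if the conditional law of the next observation tends in mean to
a primitive kernel `K` with stationary distribution `π`, and the increments of `U` tend in
mean to a function `f` of the observation, then `U / t` tends in mean to the average of `f`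
under `π`. -/
theorem tendsto_average [DecidableEq X] [Nonempty X]
    (hk : ∀ t β (F : X → ℝ), ∑ y, κ t β y * F (c y) = ∑ b, k t β (c (β (Fin.last t))) b * F b)
    (hK : IsStochastic K) (hN : ∀ a b, 0 < (K ^ N) a b)
    (hπ1 : ∑ a, π a = 1) (hπ : Matrix.vecMul π K = π)
    (hkK : ∀ a b, Tendsto (fun t => pathExpect p t fun β => |k t β a b - K a b|) atTop (𝓝 0))
    {U F : ∀ t : ℕ, (Fin (t + 1) → Y) → ℝ} {f : X → ℝ}
    (hU : ∀ t (α : Fin (t + 2) → Y), U (t + 1) α = U t (Fin.init α) + F t (Fin.init α))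
    (hF : Tendsto (fun t => pathExpect p t fun β => |F t β - f (c (β (Fin.last t)))|) atTop (𝓝 0)) :
    Tendsto (fun t : ℕ => pathExpect p t fun β => |(t : ℝ)⁻¹ * U t β - ∑ b, π b * f b|)
      atTop (𝓝 0) := by
  obtain ⟨g, hg⟩ := hK.exists_poisson hN hπ1 hπ f
  set v := ∑ b, π b * f b with hv
  set G := ∑ x, |g x| with hG
  have hgG : ∀ x, |g x| ≤ G := fun x =>
    Finset.single_le_sum (f := fun x => |g x|) (fun _ _ => abs_nonneg _) (Finset.mem_univ x)
  set n := martingalePart c k g with hn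
  -- By the Poisson equation `U t - t * v` is the martingale `n` minus the bounded term `g`, up to
  -- this remainder. Its increments involve only the errors `F - f` and `k - K`, bounded in mean by
  -- `δ`.
  set R : ∀ t : ℕ, (Fin (t + 1) → Y) → ℝ := fun t α =>
    U t α - t * v + g (c (α (Fin.last t))) - n t α with hR
  set δ : ℕ → ℝ := fun t => (pathExpect p t fun β => |F t β - f (c (β (Fin.last t)))|) +
    ∑ a, ∑ b, |g b| * pathExpect p t fun β => |k t β a b - K a b| with hδ
  have hδ0 : Tendsto δ atTop (𝓝 0) := by
    have := hF.add (tendsto_finsetSum Finset.univ fun a _ =>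
      tendsto_finsetSum Finset.univ fun b _ => (hkK a b).const_mul |g b|)
    simpa using this
  have hstep : ∀ t, (pathExpect p (t + 1) fun α => |R (t + 1) α|) ≤
      (pathExpect p t fun α => |R t α|) + δ t := by
    intro t
    simp only [hδ, ← pathExpect_const_mul]
    simp only [← pathExpect_sum]
    rw [← pathExpect_add, ← pathExpect_add]
    refine le_of_le_of_eq ?_ (hp.expect_init t _)
    refine hp.mono (t + 1) fun α => ?_
    set β := Fin.init (α := fun _ => Y) α with hβ
    set x := c (β (Fin.last t)) with hx
    have hR' : R (t + 1) α = R t β + (F t β - f x) + ∑ b, (k t β x b - K x b) * g b := by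
      simp only [hR, hn, martingalePart, hU, ← hβ, ← hx, sub_mul, Finset.sum_sub_distrib]
      push_cast
      linarith [hg x]
    have hsum : |∑ b, (k t β x b - K x b) * g b| ≤
        ∑ a, ∑ b, |g b| * |k t β a b - K a b| := by
      refine (Finset.abs_sum_le_sum_abs _ _).trans ?_
      simp only [abs_mul, mul_comm _ |g _|]
      exact Finset.single_le_sum (f := fun a => ∑ b, |g b| * |k t β a b - K a b|)
        (fun a _ => Finset.sum_nonneg fun b _ => by positivity) (Finset.mem_univ x)
    rw [hR']
    have := abs_add_le (R t β + (F t β - f x)) (∑ b, (k t β x b - K x b) * g b)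
    have := abs_add_le (R t β) (F t β - f x)
    linarith
  have hRle : ∀ t, (pathExpect p t fun α => |R t α|) ≤
      (pathExpect p 0 fun α => |R 0 α|) + ∑ j ∈ Finset.range t, δ j := by
    intro t
    induction t with
    | zero => simp
    | succ t ih => rw [Finset.sum_range_succ]; linarith [hstep t]
  have hnle : ∀ t : ℕ, (pathExpect p t fun α => |n t α|) ≤ √t * |2 * G| := fun t => by
    refine (hp.expect_abs_le_sqrt t _).trans ?_
    rw [← Real.sqrt_sq_eq_abs, ← Real.sqrt_mul (Nat.cast_nonneg t)]
    exact Real.sqrt_le_sqrt (hp.expect_martingalePart_sq_le hk hgG t)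
  have hinv : Tendsto (fun t : ℕ => (t : ℝ)⁻¹) atTop (𝓝 0) := tendsto_inv_atTop_nhds_zero_nat
  have hsq : Tendsto (fun t : ℕ => (t : ℝ)⁻¹ * √t) atTop (𝓝 0) := by
    have h1 : Tendsto (fun t : ℕ => (√(t : ℝ))⁻¹) atTop (𝓝 0) :=
      tendsto_inv_atTop_zero.comp (Real.tendsto_sqrt_atTop.comp tendsto_natCast_atTop_atTop)
    refine h1.congr fun t => ?_
    rcases eq_or_ne t 0 with rfl | ht
    · simp
    · have : (0 : ℝ) < √t := Real.sqrt_pos.2 (by positivity)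
      nth_rewrite 2 [← Real.mul_self_sqrt (Nat.cast_nonneg t)]
      field_simp
  -- After division by `t`, the bounded terms are `O(1/t)`, the martingale is `O(1/√t)`, and the
  -- remainder is a Cesàro mean of `δ`.
  have hbound : Tendsto (fun t : ℕ => (t : ℝ)⁻¹ * (G + pathExpect p 0 fun α => |R 0 α|) +
      (t : ℝ)⁻¹ * √t * |2 * G| + (t : ℝ)⁻¹ * ∑ j ∈ Finset.range t, δ j) atTop (𝓝 0) := by
    simpa using ((hinv.mul_const (G + pathExpect p 0 fun α => |R 0 α|)).add
      (hsq.mul_const |2 * G|)).add hδ0.cesaro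
  refine squeeze_zero' (Eventually.of_forall fun t => hp.expect_nonneg t fun _ => abs_nonneg _)
    ?_ hbound
  filter_upwards [eventually_gt_atTop 0] with t ht
  have ht' : (0 : ℝ) < t := by exact_mod_cast ht
  have hpt : ∀ β, |(t : ℝ)⁻¹ * U t β - v| ≤ (t : ℝ)⁻¹ * (G + (|n t β| + |R t β|)) := fun β => by
    have e : (t : ℝ)⁻¹ * U t β - v = (t : ℝ)⁻¹ * (R t β + n t β - g (c (β (Fin.last t)))) := by
      simp only [hR]
      field_simp
      ring
    rw [e, abs_mul, abs_of_pos (inv_pos.2 ht')]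
    refine mul_le_mul_of_nonneg_left ?_ (inv_pos.2 ht').le
    have := abs_sub (R t β + n t β) (g (c (β (Fin.last t))))
    have := abs_add_le (R t β) (n t β)
    have := hgG (c (β (Fin.last t)))
    linarith
  refine (hp.mono t hpt).trans ?_
  rw [pathExpect_const_mul, pathExpect_add, pathExpect_add, hp.expect_const]
  have := mul_le_mul_of_nonneg_left (add_le_add_left (add_le_add (hnle t) (hRle t)) G)
    (inv_pos.2 ht').le
  refine le_trans (by linarith) (this.trans (le_of_eq ?_))
  ring

end Observation

end IsPathLaw

/-- The marginal law of one coordinate of a product law. -/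
theorem sum_prod_mul_eq {ι Z : Type*} [Fintype ι] [DecidableEq ι] [Fintype Z] (w : ι → Z → ℝ)
    (hw : ∀ i, ∑ z, w i z = 1) (i : ι) (F : Z → ℝ) :
    ∑ x : ι → Z, (∏ j, w j (x j)) * F (x i) = ∑ z, w i z * F z := by
  have h1 : ∀ x : ι → Z, (∏ j, w j (x j)) * F (x i) =
      ∏ j, (w j (x j) * if j = i then F (x j) else 1) := fun x => by
    rw [Finset.prod_mul_distrib]
    simp
  simp only [h1]
  rw [← Fintype.prod_sum fun j z => w j z * if j = i then F z else 1, Finset.prod_eq_single i]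
  · simp
  · intro j _ hj
    simp [hj, hw]
  · simp

/-! ### Convergence of the actor-critic algorithm for fixed `ε`. -/

namespace StochasticGame

variable {I : Type*} [Fintype I] [DecidableEq I]
  {A : I → Type*} [∀ i, Fintype (A i)] [∀ i, DecidableEq (A i)]
  {S : Type*} [Fintype S] [DecidableEq S] {H : ℕ} (M : StochasticGame I A S H)

/-- The critic's `Q`-estimates after the actions `a^{(0)}, …, a^{(t)} = β` have been drawn, which
use all but the last of them. -/
noncomputable def pathQ (t : ℕ) (β : Fin (t + 1) → ActorState A S H) (h : Fin H) (s : S) (i : I)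
    (a : JointAction A) : ℝ :=
  M.criticQ (M.criticV t (Fin.init β)) i h s a

/-- The conditional law of the next actions given the past ones. -/
noncomputable def stepKernel (ε : ℝ) (t : ℕ) (β : Fin (t + 1) → ActorState A S H) (y : ActorState A S H) : ℝ :=
  ∏ h, ∏ s, logLinear ε (M.pathQ t β h s) (β (Fin.last t) h s) (y h s)

variable [Nonempty I]

theorem sum_prod_logLinear {ε : ℝ} (hε : 0 < ε) (t : ℕ) (β : Fin (t + 1) → ActorState A S H)
    (h : Fin H) :
    ∑ y : S → JointAction A,
      ∏ s, logLinear ε (M.pathQ t β h s) (β (Fin.last t) h s) (y s) = 1 := by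
  rw [← Fintype.prod_sum fun s a => logLinear ε (M.pathQ t β h s) (β (Fin.last t) h s) a]
  exact Finset.prod_eq_one fun s _ => (logLinear_isStochastic hε _).sum_eq_one _

/-- Independence over stages and states lets all other coordinates be summed out. This supplies the
hypothesis `hk` of `tendsto_law` and `tendsto_average`: the coordinate at `(h, s)` can be studied
alone, the rest entering only through the kernel. -/
theorem sum_stepKernel_mul {ε : ℝ} (hε : 0 < ε) (t : ℕ) (β : Fin (t + 1) → ActorState A S H)
    (h : Fin H) (s : S) (F : JointAction A → ℝ) :
    ∑ y, M.stepKernel ε t β y * F (y h s) =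
      ∑ b, logLinear ε (M.pathQ t β h s) (β (Fin.last t) h s) b * F b := by
  have h1 := sum_prod_mul_eq (fun h (y : S → JointAction A) =>
    ∏ s, logLinear ε (M.pathQ t β h s) (β (Fin.last t) h s) (y s))
    (M.sum_prod_logLinear hε t β) h fun y => F (y s)
  exact h1.trans (sum_prod_mul_eq (fun s a => logLinear ε (M.pathQ t β h s) (β (Fin.last t) h s) a)
    (fun s => (logLinear_isStochastic hε _).sum_eq_one _) s F)

theorem isPathLaw {ε : ℝ} (hε : 0 < ε) (μ : stdSimplex ℝ (ActorState A S H)) :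
    IsPathLaw (M.pathProb (logLinear ε) μ) (M.stepKernel ε) where
  zero_nonneg α := μ.2.1 _
  zero_sum := by
    rw [← μ.2.2]
    exact Fintype.sum_equiv (Equiv.funUnique (Fin 1) _) _ _ fun α => rfl
  kernel_nonneg t β y := Finset.prod_nonneg fun h _ => Finset.prod_nonneg fun s _ =>
    (logLinear_isStochastic hε _).nonneg _ _
  kernel_sum t β := by
    unfold stepKernel
    rw [← Fintype.prod_sum fun h (y : S → JointAction A) =>
      ∏ s, logLinear ε (M.pathQ t β h s) (β (Fin.last t) h s) (y s)]
    exact Finset.prod_eq_one fun h _ => M.sum_prod_logLinear hε t β h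
  succ _ _ := rfl

section Convergence

variable {ε : ℝ} {μ : stdSimplex ℝ (ActorState A S H)}
  {π : Policy A S H} {φ : Fin H → S → JointAction A → ℝ}

/-- If the critic's `Q`-estimates converge in mean then so do the actor's transition
probabilities. -/
theorem tendsto_logLinear_pathQ (hε : 0 < ε) {h : Fin H} {s : S}
    (hQ : ∀ i a, Tendsto (fun t => pathExpect (M.pathProb (logLinear ε) μ) t fun β =>
      |M.pathQ t β h s i a - M.Q i π h s a|) atTop (𝓝 0)) (a b : JointAction A) :
    Tendsto (fun t => pathExpect (M.pathProb (logLinear ε) μ) t fun β =>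
      |logLinear ε (M.pathQ t β h s) a b - logLinear ε (fun i => M.Q i π h s) a b|)
      atTop (𝓝 0) := by
  have hp := M.isPathLaw hε μ
  refine tendsto_order.2 ⟨fun x hx => Eventually.of_forall fun t =>
    hx.trans_le (hp.expect_nonneg t fun _ => abs_nonneg _), fun x hx => ?_⟩
  obtain ⟨C, hC, hle⟩ := exists_logLinear_sub_le hε (fun i => M.Q i π h s) a b (half_pos hx)
  have hlim : Tendsto (fun t => C * ∑ i, ∑ a, pathExpect (M.pathProb (logLinear ε) μ) t fun β =>
      |M.pathQ t β h s i a - M.Q i π h s a|) atTop (𝓝 0) := by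
    simpa using (tendsto_finsetSum Finset.univ fun i _ =>
      tendsto_finsetSum Finset.univ fun a _ => hQ i a).const_mul C
  filter_upwards [hlim.eventually_lt_const (half_pos hx)] with t ht
  refine (hp.mono t fun β => hle _).trans_lt ?_
  rw [pathExpect_add, hp.expect_const, pathExpect_const_mul, pathExpect_sum]
  simp only [pathExpect_sum]
  linarith

/-- The critic's `Q`-estimates converge in mean if its value estimates at the next stage do. -/
theorem tendsto_pathQ (hε : 0 < ε) {h : Fin H}
    (hV : ∀ (hh : (h : ℕ) + 1 < H) i s, Tendsto (fun t => pathExpect (M.pathProb (logLinear ε) μ) t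
      fun β => |M.criticV t (Fin.init β) i ⟨(h : ℕ) + 1, hh⟩ s -
        ∑ a, (π ⟨(h : ℕ) + 1, hh⟩ s).1 a * M.Q i π ⟨(h : ℕ) + 1, hh⟩ s a|) atTop (𝓝 0))
    (s : S) (i : I) (a : JointAction A) :
    Tendsto (fun t => pathExpect (M.pathProb (logLinear ε) μ) t fun β =>
      |M.pathQ t β h s i a - M.Q i π h s a|) atTop (𝓝 0) := by
  have hp := M.isPathLaw hε μ
  by_cases hh : (h : ℕ) + 1 < H
  · have hlim : Tendsto (fun t => ∑ s', (M.P h s a).1 s' *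
        pathExpect (M.pathProb (logLinear ε) μ) t
          fun β => |M.criticV t (Fin.init β) i ⟨(h : ℕ) + 1, hh⟩ s' -
            ∑ a, (π ⟨(h : ℕ) + 1, hh⟩ s').1 a * M.Q i π ⟨(h : ℕ) + 1, hh⟩ s' a|)
        atTop (𝓝 0) := by
      simpa using tendsto_finsetSum Finset.univ fun s' _ =>
        (hV hh i s').const_mul ((M.P h s a).1 s')
    refine squeeze_zero (fun t => hp.expect_nonneg t fun _ => abs_nonneg _) (fun t => ?_) hlim
    simp only [← pathExpect_const_mul]
    rw [← pathExpect_sum]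
    refine hp.mono t fun β => ?_
    rw [Q, total_eq]
    simp only [pathQ, criticQ, hh, dite_true, add_sub_add_left_eq_sub]
    rw [← Finset.sum_sub_distrib]
    refine (Finset.abs_sum_le_sum_abs _ _).trans (Finset.sum_le_sum fun s' _ => ?_)
    rw [← mul_sub, abs_mul, abs_of_nonneg ((M.P h s a).2.1 s')]
    rfl
  -- At the last stage there is no continuation value, so the critic is exact from the start.
  · have : ∀ t (β : Fin (t + 1) → ActorState A S H), |M.pathQ t β h s i a - M.Q i π h s a| = 0 :=
      fun t β => by simp [pathQ, criticQ, Q, total_eq, hh]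
    simp only [this, hp.expect_const]
    exact tendsto_const_nhds

variable [Nonempty (JointAction A)]

/-- The Markov potential property is used at the Gibbs policy itself, where it makes `M.total φ π h
s` a potential for the rewards `M.Q i π h s`. -/
theorem gibbs_policy_stationary (hε : 0 < ε) (hφ : M.IsStagePotential φ)
    (hπ : ∀ h s, π h s = gibbs (-Real.log ε) (M.total φ π h s)) (h : Fin H) (s : S) :
    Matrix.vecMul (π h s).1 (Matrix.of (logLinear ε fun i => M.Q i π h s)) = (π h s).1 := by
  rw [hπ h s]
  exact gibbs_vecMul_logLinear hε fun i a b => hφ π h s i a b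

/-- The critic's value estimates converge in mean to the values of the Gibbs policy. -/
theorem tendsto_criticV (hε : 0 < ε) (hφ : M.IsStagePotential φ)
    (hπ : ∀ h s, π h s = gibbs (-Real.log ε) (M.total φ π h s)) (h : Fin H) (i : I) (s : S) :
    Tendsto (fun t => pathExpect (M.pathProb (logLinear ε) μ) t fun β =>
      |M.criticV t (Fin.init β) i h s - ∑ a, (π h s).1 a * M.Q i π h s a|) atTop (𝓝 0) := by
  have hp := M.isPathLaw hε μ
  induction h using Fin.backward_induction generalizing i s with
  | step h ih =>
    have hQ := M.tendsto_pathQ (μ := μ) (π := π) hε (h := h) ih s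
    have hF : Tendsto (fun t => pathExpect (M.pathProb (logLinear ε) μ) t fun β =>
        |M.pathQ t β h s i (β (Fin.last t) h s) - M.Q i π h s (β (Fin.last t) h s)|)
        atTop (𝓝 0) := by
      have hlim : Tendsto (fun t => ∑ a, pathExpect (M.pathProb (logLinear ε) μ) t fun β =>
          |M.pathQ t β h s i a - M.Q i π h s a|) atTop (𝓝 0) := by
        simpa using tendsto_finsetSum Finset.univ fun a _ => hQ i a
      refine squeeze_zero (fun t => hp.expect_nonneg t fun _ => abs_nonneg _) (fun t => ?_) hlim
      rw [← pathExpect_sum]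
      exact hp.mono t fun β => Finset.single_le_sum
        (f := fun a => |M.pathQ t β h s i a - M.Q i π h s a|)
        (fun _ _ => abs_nonneg _) (Finset.mem_univ _)
    have := hp.tendsto_average (c := fun y => y h s)
      (k := fun t β => Matrix.of (logLinear ε (M.pathQ t β h s)))
      (fun t β F => M.sum_stepKernel_mul hε t β h s F)
      (logLinear_isStochastic hε _) (logLinear_pow_pos hε _) (π h s).2.2
      (M.gibbs_policy_stationary hε hφ hπ h s) (M.tendsto_logLinear_pathQ hε hQ)
      -- Multiplication by `t` undoes the averaging weights: `t * V^{(t)}` is the running sum of the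
      -- estimates at the actions played.
      (U := fun t β => t * M.criticV t (Fin.init β) i h s)
      (F := fun t β => M.pathQ t β h s i (β (Fin.last t) h s)) (f := M.Q i π h s)
      (fun t α => by
        simp only [criticV, pathQ]
        push_cast
        field_simp) hF
    refine this.congr' ?_
    filter_upwards [eventually_gt_atTop 0] with t ht
    have ht' : (t : ℝ) ≠ 0 := by exact_mod_cast ht.ne'
    simp only [inv_mul_cancel_left₀ ht']

/-- The laws of the algorithm's actions converge to the Gibbs policy. -/
theorem tendsto_actionLaw (hε : 0 < ε) (hφ : M.IsStagePotential φ)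
    (hπ : ∀ h s, π h s = gibbs (-Real.log ε) (M.total φ π h s))
    (μ : stdSimplex ℝ (ActorState A S H)) (h : Fin H) (s : S) (a : JointAction A) :
    Tendsto (fun t => M.actionLaw (logLinear ε) μ t h s a) atTop (𝓝 ((π h s).1 a)) := by
  have hp := M.isPathLaw hε μ
  have hQ := M.tendsto_pathQ (μ := μ) (π := π) hε (h := h)
    (fun hh i s => M.tendsto_criticV hε hφ hπ _ i s) s
  have := hp.tendsto_law (c := fun y => y h s)
    (k := fun t β => Matrix.of (logLinear ε (M.pathQ t β h s)))
    (fun t β F => M.sum_stepKernel_mul hε t β h s F)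
    (logLinear_isStochastic hε _) (logLinear_pow_pos hε _) (π h s).2.2
    (M.gibbs_policy_stationary hε hφ hπ h s) (M.tendsto_logLinear_pathQ hε hQ)
  refine (tendsto_pi_nhds.1 this a).congr fun t => ?_
  simp [pathExpect, actionLaw]

end Convergence

end StochasticGame

/-! ### The main theorem. -/

theorem corollary3
    {I : Type*} [Fintype I] [DecidableEq I] [Nonempty I]
    {A : I → Type*} [∀ i, Fintype (A i)] [∀ i, DecidableEq (A i)] [∀ i, Nonempty (A i)]
    {S : Type*} [Fintype S] [DecidableEq S] {H : ℕ}
    (M : StochasticGame I A S H) (hM : M.IsMarkovPotentialGame) :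
    ∃ (πε : ℝ → Policy A S H) (πs : Policy A S H),
      (∀ ε : ℝ, 0 < ε → ∀ (μ : stdSimplex ℝ (ActorState A S H))
        (h : Fin H) (s : S) (a : JointAction A),
        Tendsto (fun t : ℕ => M.actionLaw (logLinear ε) μ t h s a) atTop
          (𝓝 ((πε ε h s).1 a))) ∧
      (∀ (h : Fin H) (s : S) (a : JointAction A),
        Tendsto (fun ε : ℝ => (πε ε h s).1 a) (𝓝[>] 0) (𝓝 ((πs h s).1 a))) ∧
      ∀ φ : Fin H → S → JointAction A → ℝ, M.IsStagePotential φ →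
        M.IsPotentialMaximizing φ πs ∧
        ∀ (h : Fin H) (s : S) (a : JointAction A), 0 < (πs h s).1 a →
          ∀ a' : JointAction A, M.total φ πs h s a' ≤ M.total φ πs h s a := by
  obtain ⟨φ, hφ⟩ := hM
  -- The exponent `-Real.log ε` turns the Gibbs weights into `ε ^ (-Φ)` for `ε > 0`; the policies
  -- chosen for other `ε` play no role.
  choose πε hπε using fun ε : ℝ => M.exists_policy_of_total φ (gibbs (-Real.log ε))
  obtain ⟨πs, hπs⟩ := M.exists_policy_of_total φ uniformArgmax
  refine ⟨πε, πs, fun ε hε μ h s a => M.tendsto_actionLaw hε hφ (hπε ε) μ h s a,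
    fun h s a => (M.polyTendsto_gibbs_policy hπε hπs h s a).tendsto, fun ψ hψ => ?_⟩
  have hsupp : ∀ h s a, 0 < (πs h s).1 a → ∀ a', M.total ψ πs h s a' ≤ M.total ψ πs h s a := by
    intro h s a ha a'
    rw [hπs] at ha
    -- `πs` was built from `φ`, but `ψ` orders the actions in the same way.
    have h1 := le_of_uniformArgmax_pos ha a'
    have h2 := hφ.total_sub_total_eq hψ πs h s a a'
    linarith
  exact ⟨M.total_le_total_of_support hsupp, hsupp⟩
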